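/- Let $d_1,d_2\ge 2$ be integers with $n:=d_1+d_2=9$. Consider in coordinates $(Z,\Delta,H)\in\mathbb{R}^3$ the ODE (the Einstein equation for $SO(d_1+1)\times SO(d_2+1)$-invariant metrics on $S^{10}$) \begin{align*} Z' &= \tfrac{2}{n}\Delta\Big(d_1d_2 Z\Delta H+\tfrac{d_1d_2}{n}\Delta^2-\tfrac{n-1}{n}+(d_1-d_2)Z\Big),\\ \Delta' &= \Delta H\Big(\tfrac{d_1d_2}{n}\Delta^2-\tfrac{n-1}{n}\Big)+Z,\\ H' &= -\tfrac{1-H^2}{n}\big(d_1d_2\Delta^2+1\big), \end{align*} where $'=\frac{d}{ds}$, on the compact invariant set $$\mathcal S=\Big\{d_1Z+\tfrac{d_1d_2}{n}\Delta^2\le\tfrac{n-1}{n},\ -d_2Z+\tfrac{d_1d_2}{n}\Delta^2\le\tfrac{n-1}{n},\ H^2\le 1\Big\}.$$ Let $p_1^+=\big(\frac{d_1-1}{d_1^2},\frac1{d_1},1\big)$, a fixed point, and let $M_1^+$ be the intersection with $\mathcal S$ of its unstable manifold, i.e. the set of points of $\mathcal S$ whose trajectory converges to $p_1^+$ as $s\to-\infty$.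 Let $q_1^+(0)=\big(0,-\sqrt{\tfrac{n-1}{d_1d_2}},0\big)$. *Slice curves.* Let $0<a<b$ and let $\gamma_0:[-b,0)\to\{H=0\}$ be a continuous curve such that * the restriction of $\gamma_0$ to $[-a,0)$ is a parametrization of (a bijection onto) $M_1^+\cap\{H=0\}$, and $\gamma_0(\tau)\to(0,0,0)$ as $\tau\to 0$; * $\gamma_0(-b)=q_1^+(0)$, $\gamma_0([-b,-a])\subset\partial\mathcal S$, and $Z(\gamma_0(\tau))>0$ for $\tau\in(-b,-a]$. For $h\in(-1,1)$ and $\tau\in[-b,0)$ let $\gamma_h(\tau)$ be the intersection point of the trajectory through $\gamma_0(\tau)$ with the slice $\{H=h\}$. Identifying $\{H=h\}$ with the $(Z,\Delta)$-plane, write $\gamma_h(\tau)=|\gamma_h(\tau)|(\cos\varphi(h,\tau),\sin\varphi(h,\tau))$ with $\varphi:(-1,1)\times[-b,0)\to\mathbb R$ continuous and $\varphi(0,-b)=-\frac{\pi}{2}$. *Barrier angle.* For $\delta>0$ let $\varphi_{bar}^\delta:(-1,1)\to\mathbb R$ be the function of $h$ with $\varphi_{bar}^{\delta}(0)=\frac32\pi+\delta$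 and $$\frac{d}{ds}\varphi_{bar}^\delta(h(s))=\cos^2(\varphi_{bar}^\delta)+\frac{2(n-1)}{n^2}\sin^2(\varphi_{bar}^\delta)-\frac{n-1}{n}h(s)\sin(\varphi_{bar}^\delta)\cos(\varphi_{bar}^\delta)-\delta,\qquad h(s)=-\tanh(s/n),\ s\in\mathbb R.$$ **Proposition.** There are $\delta_0,\varepsilon_0>0$, depending only on $d_1,d_2$, such that for all $\delta\in(0,\delta_0)$, all $\varepsilon\in(0,\varepsilon_0)$ and all data as above there is $\tau_0\in(0,b]$ with $$\varphi(h,\tau)>\varphi_{bar}^{\delta}(h)\qquad\text{for all }\tau\in[-\tau_0,0)\text{ and }h\in[0,1-\varepsilon].$$ In particular, the total winding angle of $\gamma_0$ around the origin is greater than $2\pi$, in the sense that for some $c>2\pi$ and all sufficiently small $e>0$ the total winding angle of $\gamma_0|_{[-b,-e]}$ around the origin is at least $c$. -/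

import Mathlib

open Set Filter Topology

namespace EinsteinODE

/-- Points of the phase space in the coordinates `(Z, Δ, H)`. -/
abbrev Phase : Type := ℝ × ℝ × ℝ

/-- The right hand side `E(Z, Δ, H)` of the Einstein ODE for `SO(d₁+1) × SO(d₂+1)`-invariant
metrics, where `n = d₁ + d₂`. -/
noncomputable def field (d₁ d₂ : ℕ) (p : Phase) : Phase :=
  let n : ℝ := d₁ + d₂
  let Z := p.1
  let Δ := p.2.1
  let H := p.2.2
  ((2 / n) * Δ * (d₁ * d₂ * Z * Δ * H + (d₁ * d₂ / n) * Δ ^ 2 - (n - 1) / n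
      + ((d₁ : ℝ) - d₂) * Z),
    Δ * H * ((d₁ * d₂ / n) * Δ ^ 2 - (n - 1) / n) + Z,
    -((1 - H ^ 2) / n) * (d₁ * d₂ * Δ ^ 2 + 1))

/-- Solutions of the Einstein ODE that exist for all times. -/
def IsSolution (d₁ d₂ : ℕ) (c : ℝ → Phase) : Prop :=
  ∀ s, HasDerivAt c (field d₁ d₂ (c s)) s

/-- The compact region `𝒮` of phase space, cut out by `Y₁² ≥ 0`, `Y₂² ≥ 0` and `H² ≤ 1`. -/
def locus (d₁ d₂ : ℕ) : Set Phase :=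
  {p | d₁ * p.1 + (d₁ * d₂ / ((d₁ : ℝ) + d₂)) * p.2.1 ^ 2
          ≤ ((d₁ : ℝ) + d₂ - 1) / ((d₁ : ℝ) + d₂) ∧
       -(d₂ * p.1) + (d₁ * d₂ / ((d₁ : ℝ) + d₂)) * p.2.1 ^ 2
          ≤ ((d₁ : ℝ) + d₂ - 1) / ((d₁ : ℝ) + d₂) ∧
       p.2.2 ^ 2 ≤ 1}

/-- The slice `{H = h}`. -/
def slice (h : ℝ) : Set Phase := {p | p.2.2 = h}

/-- The fixed point `p₁⁺`, corresponding to a smooth collapse of the sphere `S^{d₁}`. -/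
noncomputable def p₁plus (d₁ : ℕ) : Phase := (((d₁ : ℝ) - 1) / d₁ ^ 2, 1 / d₁, 1)

/-- The point `q₁⁺(h)` of the explicit singular solution in the slice `{H = h}`. -/
noncomputable def q₁plus (d₁ d₂ : ℕ) (h : ℝ) : Phase :=
  (0, -√(((d₁ : ℝ) + d₂ - 1) / (d₁ * d₂)), h)

/-- `M₁⁺`: the unstable manifold of `p₁⁺` (the union of all trajectories that converge to `p₁⁺`
in backward time), intersected with `𝒮`. -/
def M₁plus (d₁ d₂ : ℕ) : Set Phase :=
  {p | p ∈ locus d₁ d₂ ∧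
    ∃ c : ℝ → Phase, IsSolution d₁ d₂ c ∧ c 0 = p ∧ Tendsto c atBot (𝓝 (p₁plus d₁))}

/-- Two points lie on a common trajectory of the Einstein ODE. -/
def SameTrajectory (d₁ d₂ : ℕ) (p q : Phase) : Prop :=
  ∃ c : ℝ → Phase, IsSolution d₁ d₂ c ∧ (∃ s, c s = p) ∧ ∃ s, c s = q

/-- The slice curves `γ_h : [-b, 0) → {H = h}`, `h ∈ (-1, 1)` (`γ h τ` is `γ_h(τ)`).
On `[-a, 0)` the curve `γ_0` parametrizes `M₁⁺ ∩ {H = 0}` and runs into the cone solution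
`(0, 0, 0)` as `τ → 0`; on `[-b, -a]` it runs along `∂𝒮` from `q₁⁺(0)` to `γ_0(-a)` through the
half plane `{Z > 0}`.  The other curves arise from `γ_0` by following the trajectories. -/
structure IsSliceFamily (d₁ d₂ : ℕ) (a b : ℝ) (γ : ℝ → ℝ → Phase) : Prop where
  a_pos : 0 < a
  a_lt_b : a < b
  continuousOn_zero : ContinuousOn (γ 0) (Ico (-b) 0)
  parametrizes : BijOn (γ 0) (Ico (-a) 0) (M₁plus d₁ d₂ ∩ slice 0)
  tendsto_cone : Tendsto (γ 0) (𝓝[<] 0) (𝓝 ((0, 0, 0) : Phase))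
  start : γ 0 (-b) = q₁plus d₁ d₂ 0
  mem_boundary : ∀ τ ∈ Icc (-b) (-a), γ 0 τ ∈ frontier (locus d₁ d₂) ∩ slice 0
  half_plane : ∀ τ ∈ Ioc (-b) (-a), 0 < (γ 0 τ).1
  follows : ∀ h ∈ Ioo (-1 : ℝ) 1, ∀ τ ∈ Ico (-b) 0,
    γ h τ ∈ slice h ∧ SameTrajectory d₁ d₂ (γ 0 τ) (γ h τ)

/-- The identification of the slices `{H = h}` with the plane, `(Z, Δ, h) ↦ (Z, Δ)`. -/
def toPlane (p : Phase) : ℝ × ℝ := (p.1, p.2.1)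

/-- `θ` is a polar angle of the planar point `x`: `x = |x| (cos θ, sin θ)`, where `|x|` is the
Euclidean norm. -/
def IsPolarAngle (x : ℝ × ℝ) (θ : ℝ) : Prop :=
  x.1 = √(x.1 ^ 2 + x.2 ^ 2) * Real.cos θ ∧ x.2 = √(x.1 ^ 2 + x.2 ^ 2) * Real.sin θ

/-- `φ h τ` is the continuous polar angle of `γ_h(τ)` on `(-1, 1) × [-b, 0)`, normalized by
`φ(0, -b) = -π/2`. -/
structure IsAngle (b : ℝ) (γ : ℝ → ℝ → Phase) (φ : ℝ → ℝ → ℝ) : Prop where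
  continuousOn : ContinuousOn (fun x : ℝ × ℝ => φ x.1 x.2) (Ioo (-1) 1 ×ˢ Ico (-b) 0)
  polar : ∀ h ∈ Ioo (-1 : ℝ) 1, ∀ τ ∈ Ico (-b) 0, IsPolarAngle (toPlane (γ h τ)) (φ h τ)
  normalized : φ 0 (-b) = -(Real.pi / 2)

/-- The height `h(s) = -tanh(s/n)` of the cone solution at time `s`. -/
noncomputable def coneHeight (n : ℕ) (s : ℝ) : ℝ := -Real.tanh (s / n)

/-- `φbar`, a function of `h ∈ (-1, 1)`, is the barrier angle with parameter `δ`: the solution of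
the adjusted angle ODE along the cone solution with value `3π/2 + δ` at `h = 0`. -/
structure IsBarrierAngle (n : ℕ) (δ : ℝ) (φbar : ℝ → ℝ) : Prop where
  hasDerivAt : ∀ s : ℝ, HasDerivAt (fun s => φbar (coneHeight n s))
    (Real.cos (φbar (coneHeight n s)) ^ 2
      + (2 * ((n : ℝ) - 1) / n ^ 2) * Real.sin (φbar (coneHeight n s)) ^ 2
      - (((n : ℝ) - 1) / n) * coneHeight n s
          * Real.sin (φbar (coneHeight n s)) * Real.cos (φbar (coneHeight n s))
      - δ) s
  initial : φbar 0 = 3 / 2 * Real.pi + δ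

/-- The planar curve `c : [a, b] → ℝ² \ {0}` has total winding angle `θ` around the origin. -/
def HasWindingAngle (c : ℝ → ℝ × ℝ) (a b θ : ℝ) : Prop :=
  (∀ t ∈ Icc a b, c t ≠ 0) ∧
  ∃ ϕ : ℝ → ℝ, ContinuousOn ϕ (Icc a b) ∧ (∀ t ∈ Icc a b, IsPolarAngle (c t) (ϕ t)) ∧
    θ = ϕ b - ϕ a

/-- `θ(c) > k` for a curve `c : [a, b) → ℝ² \ {0}` that runs into the origin at time `b`: for some
`k' > k`, the winding angle of the restriction of `c` to `[a, b - e]` is at least `k'` for all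
small `e > 0`. -/
def WindingAngleGT (c : ℝ → ℝ × ℝ) (a b k : ℝ) : Prop :=
  ∃ k' > k, ∀ᶠ e in 𝓝[>] (0 : ℝ), ∃ θ ≥ k', HasWindingAngle c a (b - e) θ

end EinsteinODE

namespace EinsteinODE

/-! ### Crossing arguments and scalar differential equations -/

/-! Near the cone solution (0, 0, -tanh(s/9)) the polar angle in the (Z, Δ)-plane evolves, up to
small errors, by the angle equation of the linearization, whose right hand side is `angleField`. The
barrier angle solves this equation slowed down by δ. It therefore suffices to order the two angles
near the vertex H = 1 and to propagate the order forward in time to H = 0: wherever the angles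
agree, the true angle moves faster.

The order at the vertex has two halves. First, the barrier angle is negative there
(`exists_forall_barrierAngle_neg`). With T = artanh h, so s = -9T on the cone, the Z-component of
the linearization divided by cosh⁴ T satisfies the Legendre equation of degree 4 in tanh T. The
solution vanishing at T = 0 is Q₄. Its signs +, -, + at tanh T = 1/3, 7/9, 127/129 force its
direction, started at 3π/2, to turn below -π/2. A Grönwall estimate for the Wronskian-type
expression Q₄ sin φ - Δ cos φ shows that the barrier angle does the same for small δ.

Second, the angle on the unstable manifold is positive (`IsAngle.pos`). On the boundary trajectory τ
= -a it exceeds -π/2 because Z stays positive. To carry this bound to other τ, the value -π/2 must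
be excluded near p₁⁺: smallness of `lyapunov` would force Δ to be very negative at such a point, and
Δ would then stay negative for all earlier times, contradicting convergence to p₁⁺
(`IsSolution.not_Z_eq_zero_and_Δ_neg`). Close to p₁⁺ one has Δ > 0, so the angle is positive there,
and it can cross 0 only upwards.

For γ_0(τ) close to the origin, the trajectory stays near the cone during the bounded time needed to
descend from height 1 - ε, which makes the comparison work (`exists_barrierAngle_lt`). At H = 0 the
angle then exceeds 3π/2 + δ, while it starts at -π/2; this gives the winding bound. -/

/-- A continuous function which starts positive and has positive derivative at each of its zeros
stays positive. -/
theorem pos_of_forall_zero_hasDerivAt_pos {f : ℝ → ℝ} {a b : ℝ} (hf : ContinuousOn f (Icc a b))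
    (ha : 0 < f a) (hd : ∀ t ∈ Icc a b, f t = 0 → ∃ d > 0, HasDerivAt f d t) :
    ∀ t ∈ Icc a b, 0 < f t := by
  intro t₁ ht₁
  by_contra hneg
  push Not at hneg
  have hf₁ : ContinuousOn f (Icc a t₁) := hf.mono (Icc_subset_Icc_right ht₁.2)
  have hK : IsCompact (Icc a t₁ ∩ f ⁻¹' {0}) :=
    (isCompact_Icc).of_isClosed_subset (hf₁.preimage_isClosed_of_isClosed isClosed_Icc
      isClosed_singleton) inter_subset_left
  have hne : (Icc a t₁ ∩ f ⁻¹' {0}).Nonempty := by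
    obtain ⟨t, ht, h0⟩ := intermediate_value_Icc' ht₁.1 hf₁ ⟨hneg, ha.le⟩
    exact ⟨t, ht, h0⟩
  obtain ⟨t, ⟨ht, h0⟩, hmin⟩ := hK.exists_isLeast hne
  obtain ⟨d, hd0, hder⟩ := hd t ⟨ht.1, ht.2.trans ht₁.2⟩ h0
  have hat : a < t := lt_of_le_of_ne ht.1 (by rintro rfl; exact ha.ne' h0)
  have hpos : ∀ r ∈ Ioo a t, 0 < f r := by
    intro r hr
    by_contra hr0
    push Not at hr0
    obtain ⟨q, hq, hq0⟩ := intermediate_value_Icc' hr.1.le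
      (hf₁.mono (Icc_subset_Icc_right (hr.2.le.trans ht.2))) ⟨hr0, ha.le⟩
    exact absurd (hmin ⟨⟨hq.1, hq.2.trans (hr.2.le.trans ht.2)⟩, hq0⟩)
      (not_le.2 (hq.2.trans_lt hr.2))
  -- At the first zero the left difference quotients are negative, since `f` is positive before it;
  -- this contradicts the positive derivative.
  have hsl := (hasDerivAt_iff_tendsto_slope.1 hder).mono_left
    (nhdsWithin_mono t (fun x hx => ne_of_lt hx : Iio t ⊆ {t}ᶜ))
  have h1 := (hsl.eventually (lt_mem_nhds hd0)).and (Ioo_mem_nhdsLT hat)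
  obtain ⟨r, hr, hr'⟩ := h1.exists
  have h0' : f t = 0 := h0
  rw [slope_def_field, h0'] at hr
  have := hpos r hr'
  have h3 : (0 - f r) / (t - r) < 0 := div_neg_of_neg_of_pos (by linarith) (by linarith [hr'.2])
  rw [← neg_sub, ← neg_sub t r, neg_div_neg_eq] at hr
  linarith

/-- The time reversed form of `pos_of_forall_zero_hasDerivAt_pos`. -/
theorem neg_of_forall_zero_hasDerivAt_pos {f : ℝ → ℝ} {a b : ℝ} (hf : ContinuousOn f (Icc a b))
    (hb : f b < 0) (hd : ∀ t ∈ Icc a b, f t = 0 → ∃ d > 0, HasDerivAt f d t) :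
    ∀ t ∈ Icc a b, f t < 0 := by
  have hmaps : MapsTo (fun t : ℝ => -t) (Icc (-b) (-a)) (Icc a b) := fun t ht =>
    ⟨by linarith [ht.2], by linarith [ht.1]⟩
  have key := pos_of_forall_zero_hasDerivAt_pos (f := fun t => -f (-t)) (a := -b) (b := -a)
    (hf.comp continuous_neg.continuousOn hmaps).neg (by simpa using hb) (by
      intro t ht h0
      obtain ⟨d, hd0, hder⟩ := hd (-t) (hmaps ht) (by simpa using h0)
      refine ⟨d, hd0, ?_⟩
      have := (hder.scomp t (hasDerivAt_neg t)).neg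
      simp only [smul_eq_mul, neg_mul, one_mul, neg_neg] at this
      exact this)
  intro t ht
  have := key (-t) ⟨by linarith [ht.2], by linarith [ht.1]⟩
  simpa using this

/-- Solutions of a scalar homogeneous linear differential equation are given by an exponential. -/
theorem eq_mul_exp_integral_of_hasDerivAt {u k : ℝ → ℝ} (hk : Continuous k)
    (hu : ∀ s, HasDerivAt u (k s * u s) s) (s₀ s : ℝ) :
    u s = u s₀ * Real.exp (∫ t in s₀..s, k t) := by
  have hint : ∀ s, HasDerivAt (fun s => ∫ t in s₀..s, k t) (k s) s := fun s =>
    intervalIntegral.integral_hasDerivAt_right (hk.intervalIntegrable _ _)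
      hk.stronglyMeasurable.stronglyMeasurableAtFilter hk.continuousAt
  have hder : ∀ s, HasDerivAt (fun s => u s * Real.exp (-∫ t in s₀..s, k t)) 0 s := fun s => by
    convert! (hu s).mul (hint s).neg.exp using 1
    ring
  have hc := is_const_of_deriv_eq_zero (fun s => (hder s).differentiableAt)
    (fun s => (hder s).deriv) s s₀
  simp only [intervalIntegral.integral_same, neg_zero, Real.exp_zero, mul_one] at hc
  rw [← hc, mul_assoc, ← Real.exp_add]
  simp

/-- Grönwall's inequality for a scalar differential equation with an inhomogeneity. -/
theorem abs_le_gronwallBound_of_hasDerivAt {f f' : ℝ → ℝ} {δ K ε b : ℝ}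
    (hf : ∀ t, HasDerivAt f (f' t) t) (h0 : |f 0| ≤ δ)
    (hb : ∀ t ∈ Ico 0 b, |f' t| ≤ K * |f t| + ε) : ∀ t ∈ Icc 0 b, |f t| ≤ gronwallBound δ K ε t := by
  intro t ht
  have := norm_le_gronwallBound_of_norm_deriv_right_le (f := f) (f' := f') (δ := δ) (K := K)
    (ε := ε) (a := 0) (b := b) (fun t _ => (hf t).continuousAt.continuousWithinAt)
    (fun t _ => (hf t).hasDerivWithinAt) h0 hb t ht
  simpa using this

/-- A continuous polar angle of a differentiable planar curve is differentiable. -/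
theorem hasDerivAt_of_isPolarAngle {X Y ψ : ℝ → ℝ} {X' Y' s : ℝ} (hψ : ContinuousAt ψ s)
    (hX : HasDerivAt X X' s) (hY : HasDerivAt Y Y' s) (hne : X s ≠ 0 ∨ Y s ≠ 0)
    (hp : ∀ᶠ t in 𝓝 s, IsPolarAngle (X t, Y t) (ψ t)) :
    HasDerivAt ψ ((X s * Y' - Y s * X') / (X s ^ 2 + Y s ^ 2)) s := by
  have hr0 : 0 < X s ^ 2 + Y s ^ 2 := by
    rcases hne with h | h <;> positivity
  set r := √(X s ^ 2 + Y s ^ 2) with hr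
  have hrpos : 0 < r := Real.sqrt_pos.2 hr0
  have hrr : r ^ 2 = X s ^ 2 + Y s ^ 2 := Real.sq_sqrt hr0.le
  obtain ⟨hXs, hYs⟩ := hp.self_of_nhds
  simp only [← hr] at hXs hYs
  set θ := ψ s with hθ
  -- These are the coordinates of the curve in the frame rotated by θ. Near `s` the angle is θ plus
  -- the arctangent of their quotient, which is differentiable.
  have hden : HasDerivAt (fun t => X t * Real.cos θ + Y t * Real.sin θ)
      (X' * Real.cos θ + Y' * Real.sin θ) s := (hX.mul_const _).add (hY.mul_const _)
  have hnum : HasDerivAt (fun t => Y t * Real.cos θ - X t * Real.sin θ)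
      (Y' * Real.cos θ - X' * Real.sin θ) s := (hY.mul_const _).sub (hX.mul_const _)
  have hcs := Real.sin_sq_add_cos_sq θ
  have hden0 : X s * Real.cos θ + Y s * Real.sin θ = r := by
    rw [hXs, hYs]; linear_combination r * hcs
  have hnum0 : Y s * Real.cos θ - X s * Real.sin θ = 0 := by
    rw [hXs, hYs]; ring
  have h1 := ((hnum.div hden (by rw [hden0]; exact hrpos.ne')).arctan).const_add θ
  rw [hden0, hnum0] at h1
  have hval : 1 / (1 + (0 / r) ^ 2) * (((Y' * Real.cos θ - X' * Real.sin θ) * r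
      - 0 * (X' * Real.cos θ + Y' * Real.sin θ)) / r ^ 2)
      = (X s * Y' - Y s * X') / (X s ^ 2 + Y s ^ 2) := by
    rw [← hrr, hXs, hYs]; field_simp; ring
  simp only [Pi.div_apply, hden0, hnum0] at h1
  rw [hval] at h1
  refine h1.congr_of_eventuallyEq ?_
  have hnear : ∀ᶠ t in 𝓝 s, ψ t ∈ Ioo (θ - Real.pi / 2) (θ + Real.pi / 2) :=
    hψ.eventually (Ioo_mem_nhds (by linarith [Real.pi_pos]) (by linarith [Real.pi_pos]))
  have hdpos : ∀ᶠ t in 𝓝 s, 0 < X t * Real.cos θ + Y t * Real.sin θ :=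
    hden.continuousAt.eventually (lt_mem_nhds (hrpos.trans_eq hden0.symm))
  filter_upwards [hp, hnear, hdpos] with t ⟨hXt, hYt⟩ hn hdp
  simp only at hXt hYt
  set ρ := √(X t ^ 2 + Y t ^ 2)
  have e1 : X t * Real.cos θ + Y t * Real.sin θ = ρ * Real.cos (ψ t - θ) := by
    rw [Real.cos_sub]; linear_combination Real.cos θ * hXt + Real.sin θ * hYt
  have e2 : Y t * Real.cos θ - X t * Real.sin θ = ρ * Real.sin (ψ t - θ) := by
    rw [Real.sin_sub]; linear_combination Real.cos θ * hYt - Real.sin θ * hXt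
  have hρ : ρ ≠ 0 := by
    intro h; rw [e1, h, zero_mul] at hdp; exact lt_irrefl _ hdp
  rw [e1, e2, mul_div_mul_left _ _ hρ, ← Real.tan_eq_sin_div_cos,
    Real.arctan_tan (by linarith [hn.1]) (by linarith [hn.2])]
  ring

/-! ### The barrier angle near the vertex of the cone -/

theorem hasDerivAt_tanh (t : ℝ) : HasDerivAt Real.tanh (1 - Real.tanh t ^ 2) t := by
  have h := (Real.hasDerivAt_sinh t).div (Real.hasDerivAt_cosh t) (Real.cosh_pos t).ne'
  have he : Real.tanh = Real.sinh / Real.cosh := by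
    funext x; rw [Pi.div_apply, Real.tanh_eq_sinh_div_cosh]
  rw [he]
  convert! h using 1
  have := (Real.cosh_pos t).ne'
  simp only [Pi.div_apply]
  field_simp

theorem tanh_mem_Ioo (t : ℝ) : Real.tanh t ∈ Ioo (-1 : ℝ) 1 :=
  ⟨Real.neg_one_lt_tanh t, Real.tanh_lt_one t⟩

/-! ### Explicit solution of the linearization along the cone -/

/-- The Legendre function `Q₄(tanh T)` of the second kind. -/
noncomputable def legendreQ (T : ℝ) : ℝ :=
  (35 * Real.tanh T ^ 4 - 30 * Real.tanh T ^ 2 + 3) / 8 * T - 35 / 8 * Real.tanh T ^ 3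
    + 55 / 24 * Real.tanh T

/-- The derivative of `legendreQ`. -/
noncomputable def legendreQ' (T : ℝ) : ℝ :=
  (140 * Real.tanh T ^ 3 - 60 * Real.tanh T) / 8 * (1 - Real.tanh T ^ 2) * T
    + (35 * Real.tanh T ^ 4 - 30 * Real.tanh T ^ 2 + 3) / 8
    + (1 - Real.tanh T ^ 2) * (55 / 24 - 105 / 8 * Real.tanh T ^ 2)

/-- The `Δ`-component of the solution of the linearization along the cone whose `Z`-component
is `legendreQ`, up to a common positive factor. -/
noncomputable def legendreΔ (T : ℝ) : ℝ :=
  9 / 16 * (4 * Real.tanh T * legendreQ T + legendreQ' T)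

theorem hasDerivAt_legendreQ (T : ℝ) : HasDerivAt legendreQ (legendreQ' T) T := by
  have ht := hasDerivAt_tanh T
  have h := ((((((ht.pow 4).const_mul 35).sub ((ht.pow 2).const_mul 30)).add_const 3).div_const
    8).mul (hasDerivAt_id T)).sub ((ht.pow 3).const_mul (35 / 8)) |>.add (ht.const_mul (55 / 24))
  convert! h using 1
  simp only [legendreQ', Pi.sub_apply, Pi.pow_apply, id]
  push_cast
  ring

theorem hasDerivAt_legendreQ' (T : ℝ) : HasDerivAt legendreQ'
    (-(20 * (1 - Real.tanh T ^ 2)) * legendreQ T) T := by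
  have ht := hasDerivAt_tanh T
  have h1 := ((((ht.pow 3).const_mul 140).sub (ht.const_mul 60)).div_const 8).mul
    ((ht.pow 2).const_sub 1) |>.mul (hasDerivAt_id T)
  have h2 := ((((ht.pow 4).const_mul 35).sub ((ht.pow 2).const_mul 30)).add_const 3).div_const 8
  have h3 := ((ht.pow 2).const_sub 1).mul (((ht.pow 2).const_mul (105 / 8)).const_sub (55 / 24))
  convert! (h1.add h2).add h3 using 1
  simp only [legendreQ, Pi.sub_apply, Pi.pow_apply, Pi.mul_apply, id]
  push_cast
  ring

theorem hasDerivAt_legendreΔ (T : ℝ) : HasDerivAt legendreΔ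
    (4 * Real.tanh T * legendreΔ T - 9 * legendreQ T) T := by
  have h := ((((hasDerivAt_tanh T).const_mul 4).mul (hasDerivAt_legendreQ T)).add
    (hasDerivAt_legendreQ' T)).const_mul (9 / 16)
  convert! h using 1
  simp only [legendreΔ]
  ring

theorem continuous_legendreQ : Continuous legendreQ :=
  continuous_iff_continuousAt.2 fun T => (hasDerivAt_legendreQ T).continuousAt

theorem continuous_legendreΔ : Continuous legendreΔ :=
  continuous_iff_continuousAt.2 fun T => (hasDerivAt_legendreΔ T).continuousAt

/-- The Wronskian of the two Legendre functions does not vanish. -/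
theorem legendre_sq_add_sq_pos (T : ℝ) : 0 < legendreQ T ^ 2 + legendreΔ T ^ 2 := by
  by_contra h
  have h1 : legendreQ T = 0 := by nlinarith [sq_nonneg (legendreQ T), sq_nonneg (legendreΔ T)]
  have h2 : legendreΔ T = 0 := by nlinarith [sq_nonneg (legendreQ T), sq_nonneg (legendreΔ T)]
  have h3 : legendreQ' T = 0 := by rw [legendreΔ, h1] at h2; linarith
  -- Wronskian of P₄ and Q₄ with respect to T.
  have key : (35 * Real.tanh T ^ 4 - 30 * Real.tanh T ^ 2 + 3) / 8 * legendreQ' T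
      - (140 * Real.tanh T ^ 3 - 60 * Real.tanh T) / 8 * (1 - Real.tanh T ^ 2) * legendreQ T
      = 1 := by
    simp only [legendreQ, legendreQ']; ring
  rw [h1, h3] at key
  norm_num at key

/-- At such points Q₄ is a rational combination of 1 and log 2, so decimal bounds on log 2 decide
its sign. -/
theorem artanh_eq_mul_log_two {x : ℝ} (k : ℕ) (hx : x ∈ Ioo (-1 : ℝ) 1)
    (h : (1 + x) / (1 - x) = 2 ^ k) : Real.artanh x = k / 2 * Real.log 2 := by
  rw [Real.artanh_eq_half_log (Ioo_subset_Icc_self hx), h, Real.log_pow]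
  ring

/-- The sign pattern +, -, + of this and the next two lemmas provides the two sign changes that turn
the barrier angle past π/2 and -π/2. -/
theorem legendreQ_artanh_one_third : 0 < legendreQ (Real.artanh (1 / 3)) := by
  have hx : (1 / 3 : ℝ) ∈ Ioo (-1 : ℝ) 1 := by norm_num
  rw [legendreQ, Real.tanh_artanh hx, artanh_eq_mul_log_two 1 hx (by norm_num)]
  have := Real.log_two_gt_d9
  have := Real.log_two_lt_d9
  push_cast; linarith

theorem legendreQ_artanh_seven_ninths : legendreQ (Real.artanh (7 / 9)) < 0 := by
  have hx : (7 / 9 : ℝ) ∈ Ioo (-1 : ℝ) 1 := by norm_num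
  rw [legendreQ, Real.tanh_artanh hx, artanh_eq_mul_log_two 3 hx (by norm_num)]
  have := Real.log_two_gt_d9
  have := Real.log_two_lt_d9
  push_cast; linarith

theorem legendreQ_artanh_last : 0 < legendreQ (Real.artanh (127 / 129)) := by
  have hx : (127 / 129 : ℝ) ∈ Ioo (-1 : ℝ) 1 := by norm_num
  rw [legendreQ, Real.tanh_artanh hx, artanh_eq_mul_log_two 7 hx (by norm_num)]
  have := Real.log_two_gt_d9
  have := Real.log_two_lt_d9
  push_cast; linarith

/-! ### Barrier angle versus the direction of the Legendre solution -/

/-- The right hand side of the angle equation of the linearization along the cone. -/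
noncomputable def angleField (h θ : ℝ) : ℝ :=
  Real.cos θ ^ 2 + 16 / 81 * Real.sin θ ^ 2 - 8 / 9 * h * Real.sin θ * Real.cos θ

theorem IsBarrierAngle.hasDerivAt_comp_tanh {δ : ℝ} {φbar : ℝ → ℝ} (h : IsBarrierAngle 9 δ φbar)
    (T : ℝ) : HasDerivAt (fun T => φbar (Real.tanh T))
      (-9 * (angleField (Real.tanh T) (φbar (Real.tanh T)) - δ)) T := by
  have h1 := (h.hasDerivAt (-9 * T)).scomp T ((hasDerivAt_id T).const_mul (-9))
  have e : ∀ T, coneHeight 9 (-9 * T) = Real.tanh T := fun T => by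
    rw [coneHeight, show -9 * T / ((9 : ℕ) : ℝ) = -T by push_cast; ring, Real.tanh_neg, neg_neg]
  simp only [Function.comp_def, e, smul_eq_mul] at h1
  convert! h1 using 1
  simp only [angleField]
  push_cast
  ring

/-- The barrier angle can cross the values at which the angle field exceeds `δ` only downwards
as `T` increases. -/
theorem IsBarrierAngle.lt_of_lt {δ : ℝ} {φbar : ℝ → ℝ} (h : IsBarrierAngle 9 δ φbar) {v : ℝ}
    (hv : ∀ x, δ < angleField x v) {T₁ T₂ : ℝ} (hT : T₁ ≤ T₂) (h1 : φbar (Real.tanh T₁) < v) :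
    φbar (Real.tanh T₂) < v := by
  have := pos_of_forall_zero_hasDerivAt_pos (f := fun T => v - φbar (Real.tanh T)) (a := T₁)
    (b := T₂) (fun T _ => ((h.hasDerivAt_comp_tanh T).const_sub
      v).continuousAt.continuousWithinAt) (by linarith) (fun T _ h0 => ?_) T₂ ⟨hT, le_rfl⟩
  · linarith
  · refine ⟨_, ?_, (h.hasDerivAt_comp_tanh T).const_sub v⟩
    have : φbar (Real.tanh T) = v := by linarith
    rw [this]
    linarith [hv (Real.tanh T)]

/-- The barrier angle stays close to the direction of the explicit Legendre solution. -/
theorem IsBarrierAngle.abs_wronskian_le {δ Q b : ℝ} {φbar : ℝ → ℝ} (h : IsBarrierAngle 9 δ φbar)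
    (hδ : 0 < δ) (hQ : ∀ T ∈ Icc 0 b, |legendreQ T| + |legendreΔ T| ≤ Q) :
    ∀ T ∈ Icc 0 b, |legendreQ T * Real.sin (φbar (Real.tanh T))
      - legendreΔ T * Real.cos (φbar (Real.tanh T))|
      ≤ δ * (gronwallBound (3 / 2) 20 (9 * Q) b) := by
  intro T hT
  have hQ0 : 0 ≤ Q := (by positivity : 0 ≤ |legendreQ T| + |legendreΔ T|).trans (hQ T hT)
  set P : ℝ → ℝ := fun T => φbar (Real.tanh T) with hP
  -- For δ = 0 this expression satisfies a homogeneous linear equation, because a solution of the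
  -- angle equation remains parallel to the Legendre vector; δ enters only as an inhomogeneity.
  have hder : ∀ T, HasDerivAt (fun T => legendreQ T * Real.sin (P T)
      - legendreΔ T * Real.cos (P T))
      ((4 * Real.tanh T + 9 * (65 / 81 * (Real.cos (P T) * Real.sin (P T))
        - 8 / 9 * Real.tanh T * Real.sin (P T) ^ 2)) *
        (legendreQ T * Real.sin (P T) - legendreΔ T * Real.cos (P T))
        + 9 * δ * (legendreQ T * Real.cos (P T) + legendreΔ T * Real.sin (P T))) T := by
    intro T
    have hPT : HasDerivAt P (-9 * (angleField (Real.tanh T) (P T) - δ)) T :=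
      h.hasDerivAt_comp_tanh T
    have hd := ((hasDerivAt_legendreQ T).mul hPT.sin).sub
      ((hasDerivAt_legendreΔ T).mul hPT.cos)
    convert! hd using 1
    have e1 : legendreQ' T = 16 / 9 * legendreΔ T - 4 * Real.tanh T * legendreQ T := by
      rw [legendreΔ]; ring
    have hcs := Real.sin_sq_add_cos_sq (P T)
    rw [e1, angleField]
    generalize Real.sin (P T) = S at *
    generalize Real.cos (P T) = C at *
    generalize legendreQ T = q at *
    generalize legendreΔ T = r at *
    generalize Real.tanh T = x at *
    linear_combination -(8 * x * q * S - 16 / 9 * r * S - 9 * q * C) * hcs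
  have hR : ∀ T ∈ Icc 0 b, |legendreQ T * Real.cos (P T) + legendreΔ T * Real.sin (P T)| ≤ Q := by
    intro T hT
    refine le_trans ?_ (hQ T hT)
    refine (abs_add_le _ _).trans (add_le_add ?_ ?_)
    · rw [abs_mul]
      exact mul_le_of_le_one_right (abs_nonneg _) (Real.abs_cos_le_one _)
    · rw [abs_mul]
      exact mul_le_of_le_one_right (abs_nonneg _) (Real.abs_sin_le_one _)
  have h0 : |legendreQ 0 * Real.sin (P 0) - legendreΔ 0 * Real.cos (P 0)| ≤ δ * (3 / 2) := by
    have e0 : P 0 = 3 / 2 * Real.pi + δ := by simp [hP, h.initial]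
    have e1 : legendreQ 0 = 0 := by simp [legendreQ]
    have e2 : legendreΔ 0 = 3 / 2 := by simp [legendreΔ, legendreQ, legendreQ']; norm_num
    have e3 : Real.cos (3 / 2 * Real.pi + δ) = Real.sin δ := by
      rw [show 3 / 2 * Real.pi + δ = δ - Real.pi / 2 + 2 * Real.pi by ring, Real.cos_add_two_pi,
        Real.cos_sub_pi_div_two]
    rw [e0, e1, e2, e3, zero_mul, zero_sub, abs_neg, abs_mul, abs_of_pos (by norm_num : (0:ℝ) < 3/2)]
    have := Real.abs_sin_le_abs (x := δ)
    rw [abs_of_pos hδ] at this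
    linarith
  -- The linear coefficient is at most 4 + 9 (65/81 + 8/9) < 20.
  have key := abs_le_gronwallBound_of_hasDerivAt (K := 20) (ε := δ * (9 * Q)) (b := b) hder h0 (by
    intro T hT
    have hx := tanh_mem_Ioo T
    have hx' : |Real.tanh T| ≤ 1 := abs_le.2 ⟨hx.1.le, hx.2.le⟩
    refine (abs_add_le _ _).trans (add_le_add ?_ ?_)
    · rw [abs_mul]
      refine mul_le_mul_of_nonneg_right ?_ (abs_nonneg _)
      have hcs : |Real.cos (P T) * Real.sin (P T)| ≤ 1 := by
        rw [abs_mul]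
        exact mul_le_one₀ (Real.abs_cos_le_one _) (abs_nonneg _) (Real.abs_sin_le_one _)
      have hs : |Real.tanh T * Real.sin (P T) ^ 2| ≤ 1 := by
        rw [abs_mul]
        refine mul_le_one₀ hx' (abs_nonneg _) ?_
        rw [abs_of_nonneg (sq_nonneg _)]
        exact Real.sin_sq_le_one _
      rw [abs_le] at *
      constructor <;> linarith [hcs.1, hcs.2, hs.1, hs.2, hx'.1, hx'.2]
    · have := hR T (Ico_subset_Icc_self hT)
      rw [abs_mul, abs_of_pos (by positivity : 0 < 9 * δ)]
      nlinarith) T hT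
  refine key.trans ?_
  have hT0 := hT.1
  have hTb := hT.2
  rw [gronwallBound_of_K_ne_0 (by norm_num), gronwallBound_of_K_ne_0 (by norm_num)]
  have hmono : Real.exp (20 * T) ≤ Real.exp (20 * b) := Real.exp_le_exp.2 (by linarith)
  have h2 : δ * (3 / 2) * Real.exp (20 * T) + δ * (9 * Q) / 20 * (Real.exp (20 * T) - 1)
      = δ * (3 / 2 * Real.exp (20 * T) + 9 * Q / 20 * (Real.exp (20 * T) - 1)) := by ring
  simp only [h2]
  gcongr

/-- For small `δ` the barrier angle is negative close to the vertex of the cone. -/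
theorem exists_forall_barrierAngle_neg : ∃ δ₀ > (0 : ℝ), δ₀ ≤ 1 / 10 ∧ ∀ δ ∈ Ioo 0 δ₀,
    ∀ φbar : ℝ → ℝ, IsBarrierAngle 9 δ φbar → ∀ h ∈ Ico (127 / 129 : ℝ) 1, φbar h < 0 := by
  set b := Real.artanh (127 / 129) with hb
  set T₁ := Real.artanh (1 / 3) with hT₁
  set T₂ := Real.artanh (7 / 9) with hT₂
  have hT₁0 : 0 ≤ T₁ := Real.artanh_nonneg (by norm_num)
  have hT₁₂ : T₁ ≤ T₂ := Real.artanh_le_artanh (by norm_num) (by norm_num) (by norm_num)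
  have hT₂b : T₂ ≤ b := Real.artanh_le_artanh (by norm_num) (by norm_num) (by norm_num)
  have hne : (Icc 0 b).Nonempty := ⟨0, le_rfl, by linarith⟩
  obtain ⟨TQ, -, hTQ⟩ := isCompact_Icc.exists_isMaxOn hne
    (f := fun T => |legendreQ T| + |legendreΔ T|)
    (continuous_legendreQ.abs.add continuous_legendreΔ.abs).continuousOn
  obtain ⟨Tm, -, hTm⟩ := isCompact_Icc.exists_isMinOn hne
    (f := fun T => legendreQ T ^ 2 + legendreΔ T ^ 2)
    ((continuous_legendreQ.pow 2).add (continuous_legendreΔ.pow 2)).continuousOn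
  set C := gronwallBound (3 / 2) 20 (9 * (|legendreQ TQ| + |legendreΔ TQ|)) b
  have hm := legendre_sq_add_sq_pos Tm
  have h1 : 0 < legendreQ T₁ := legendreQ_artanh_one_third
  have h2 : legendreQ T₂ < 0 := legendreQ_artanh_seven_ninths
  have h3 : 0 < legendreQ b := legendreQ_artanh_last
  have hsmall : ∀ᶠ δ in 𝓝[>] (0 : ℝ), (δ * C) ^ 2 < legendreQ Tm ^ 2 + legendreΔ Tm ^ 2 ∧
      δ * C < legendreQ T₁ ∧ δ * C < -legendreQ T₂ ∧ δ * C < legendreQ b := by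
    have hc : Tendsto (fun δ : ℝ => δ * C) (𝓝[>] 0) (𝓝 0) := by
      have : Continuous fun δ : ℝ => δ * C := by fun_prop
      simpa using (this.tendsto 0).mono_left nhdsWithin_le_nhds
    refine ((hc.pow 2).eventually (gt_mem_nhds (by simpa using hm))).and
      ((hc.eventually (gt_mem_nhds h1)).and ((hc.eventually (gt_mem_nhds (by linarith))).and
        (hc.eventually (gt_mem_nhds h3))))
  obtain ⟨δ₁, hδ₁, hsm⟩ := mem_nhdsGT_iff_exists_Ioo_subset.1 hsmall
  refine ⟨min δ₁ (1 / 10), lt_min hδ₁ (by norm_num), min_le_right _ _, ?_⟩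
  intro δ hδ φbar h x hx
  obtain ⟨hs0, hs1, hs2, hs3⟩ := hsm ⟨hδ.1, hδ.2.trans_le (min_le_left _ _)⟩
  have hδ10 : δ < 1 / 10 := hδ.2.trans_le (min_le_right _ _)
  have hE := h.abs_wronskian_le hδ.1 (b := b) (fun T hT => hTQ hT)
  change ∀ T ∈ Icc 0 b, _ ≤ δ * C at hE
  set P : ℝ → ℝ := fun T => φbar (Real.tanh T) with hP
  have hPc : Continuous P :=
    continuous_iff_continuousAt.2 fun T => (h.hasDerivAt_comp_tanh T).continuousAt
  have hpi := Real.pi_gt_three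
  have e0 : P 0 = 3 / 2 * Real.pi + δ := by simp [hP, h.initial]
  -- The component of -(Q₄, Δ) in the direction of the barrier angle. The minus sign is needed
  -- because the Legendre vector starts in direction π/2, the barrier near 3π/2.
  set R : ℝ → ℝ := fun T => -(legendreQ T * Real.cos (P T) + legendreΔ T * Real.sin (P T))
  have hRc : Continuous R := ((continuous_legendreQ.mul (Real.continuous_cos.comp hPc)).add
    (continuous_legendreΔ.mul (Real.continuous_sin.comp hPc))).neg
  have hsum : ∀ T, R T ^ 2 + (legendreQ T * Real.sin (P T) - legendreΔ T * Real.cos (P T)) ^ 2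
      = legendreQ T ^ 2 + legendreΔ T ^ 2 := fun T => by
    linear_combination (legendreQ T ^ 2 + legendreΔ T ^ 2) * Real.sin_sq_add_cos_sq (P T)
  have hR0 : 0 < R 0 := by
    have e1 : legendreQ 0 = 0 := by simp [legendreQ]
    have e2 : legendreΔ 0 = 3 / 2 := by simp [legendreΔ, legendreQ, legendreQ']; norm_num
    have e3 : Real.sin (3 / 2 * Real.pi + δ) = -Real.cos δ := by
      rw [show 3 / 2 * Real.pi + δ = δ - Real.pi / 2 + 2 * Real.pi by ring, Real.sin_add_two_pi,
        Real.sin_sub_pi_div_two]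
    have : 0 < Real.cos δ := Real.cos_pos_of_mem_Ioo ⟨by linarith [hδ.1], by linarith⟩
    simp only [R, e0, e1, e2, e3]
    linarith
  have hRpos : ∀ T ∈ Icc 0 b, 0 < R T := by
    -- The derivative condition is vacuous: at a zero of `R` the other component would carry the
    -- full length of the Legendre vector, exceeding the bound δC.
    refine pos_of_forall_zero_hasDerivAt_pos hRc.continuousOn hR0 fun T hT h0 => ?_
    have := hsum T
    rw [h0] at this
    have h4 := sq_le_sq' (abs_le.1 (hE T hT)).1 (abs_le.1 (hE T hT)).2
    have h5 : legendreQ Tm ^ 2 + legendreΔ Tm ^ 2 ≤ legendreQ T ^ 2 + legendreΔ T ^ 2 := hTm hT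
    linarith
  have hQ : ∀ T ∈ Icc 0 b, |legendreQ T + R T * Real.cos (P T)| ≤ δ * C := by
    intro T hT
    have e : legendreQ T + R T * Real.cos (P T)
        = (legendreQ T * Real.sin (P T) - legendreΔ T * Real.cos (P T)) * Real.sin (P T) := by
      linear_combination -legendreQ T * Real.sin_sq_add_cos_sq (P T)
    rw [e, abs_mul]
    exact (mul_le_of_le_one_right (abs_nonneg _) (Real.abs_sin_le_one _)).trans (hE T hT)
  have hcos_neg : ∀ T ∈ Icc 0 b, δ * C < legendreQ T → Real.cos (P T) < 0 := fun T hT hlt => by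
    have := (abs_le.1 (hQ T hT)).2
    by_contra hc
    have := mul_nonneg (hRpos T hT).le (not_lt.1 hc)
    linarith
  have hcos_pos : ∀ T ∈ Icc 0 b, δ * C < -legendreQ T → 0 < Real.cos (P T) := fun T hT hlt => by
    have := (abs_le.1 (hQ T hT)).1
    by_contra hc
    have := mul_nonpos_of_nonneg_of_nonpos (hRpos T hT).le (not_lt.1 hc)
    linarith
  -- Sine or cosine vanishes at these angles, so the term with `h` drops out and the field is 1 or
  -- 16/81, both above 1/10 > δ.
  have s2π : ∀ x, δ < angleField x (2 * Real.pi) := fun x => by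
    simp [angleField]; linarith
  have s1 : ∀ x, δ < angleField x (Real.pi / 2) := fun x => by
    simp [angleField]; linarith
  have s3 : ∀ x, δ < angleField x (-(Real.pi / 2)) := fun x => by
    simp [angleField]; linarith
  have s4 : ∀ x, δ < angleField x (Real.pi / 2 + Real.pi) := fun x => by
    simp [angleField, Real.cos_add_pi, Real.sin_add_pi]; linarith
  have hm₁ : T₁ ∈ Icc 0 b := ⟨hT₁0, hT₁₂.trans hT₂b⟩
  have hm₂ : T₂ ∈ Icc 0 b := ⟨hT₁0.trans hT₁₂, hT₂b⟩
  have hmb : b ∈ Icc 0 b := ⟨hm₁.1.trans hm₁.2, le_rfl⟩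
  -- Crossings of these levels go only downwards in T. The sign of the cosine at T₁, T₂ and b then
  -- pushes the angle below 3π/2, π/2 and -π/2 in turn.
  have a0 : P T₁ < 2 * Real.pi := h.lt_of_lt s2π hT₁0 (by change P 0 < _; rw [e0]; linarith)
  have a1 : P T₁ < Real.pi / 2 + Real.pi := by
    by_contra hc
    have := Real.cos_nonneg_of_mem_Icc (x := P T₁ - 2 * Real.pi) ⟨by linarith, by linarith⟩
    rw [Real.cos_sub_two_pi] at this
    linarith [hcos_neg T₁ hm₁ hs1]
  have a2 : P T₂ < Real.pi / 2 := by
    have := h.lt_of_lt s4 hT₁₂ a1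
    by_contra hc
    have := Real.cos_nonpos_of_pi_div_two_le_of_le (x := P T₂) (not_lt.1 hc)
      (by change P T₂ < _ at this; linarith)
    linarith [hcos_pos T₂ hm₂ hs2]
  have a3 : P b < -(Real.pi / 2) := by
    have := h.lt_of_lt s1 hT₂b a2
    by_contra hc
    have := Real.cos_nonneg_of_mem_Icc (x := P b) ⟨not_lt.1 hc, le_of_lt this⟩
    linarith [hcos_neg b hmb hs3]
  have hx' : x ∈ Ioo (-1 : ℝ) 1 := ⟨by linarith [hx.1], hx.2⟩
  have := h.lt_of_lt s3 (T₂ := Real.artanh x)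
    (Real.artanh_le_artanh (by norm_num) hx.2 hx.1) a3
  rw [Real.tanh_artanh hx'] at this
  linarith

/-! ### The Einstein ODE in dimension ten -/

/-- The defining function of the face of `locus` that carries `p₂⁺`. -/
noncomputable def faceU (d₁ d₂ : ℕ) (p : Phase) : ℝ :=
  8 / 9 - d₁ * d₂ / 9 * p.2.1 ^ 2 + d₂ * p.1

/-- The defining function of the face of `locus` that carries `p₁⁺`. -/
noncomputable def faceW (d₁ d₂ : ℕ) (p : Phase) : ℝ :=
  8 / 9 - d₁ * d₂ / 9 * p.2.1 ^ 2 - d₁ * p.1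

variable {d₁ d₂ : ℕ}

theorem cast_add_eq_nine (hn : d₁ + d₂ = 9) : (d₁ : ℝ) + d₂ = 9 := by exact_mod_cast hn

theorem fourteen_le_mul (hd₁ : 2 ≤ d₁) (hd₂ : 2 ≤ d₂) (hn : d₁ + d₂ = 9) :
    (14 : ℝ) ≤ d₁ * d₂ := by
  have h1 : (2 : ℝ) ≤ d₁ := by exact_mod_cast hd₁
  have h2 : (2 : ℝ) ≤ d₂ := by exact_mod_cast hd₂
  nlinarith [cast_add_eq_nine hn]

theorem mul_le_twenty_one (hn : d₁ + d₂ = 9) : (d₁ : ℝ) * d₂ ≤ 21 := by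
  nlinarith [cast_add_eq_nine hn, sq_nonneg ((d₁ : ℝ) - d₂)]

theorem mem_locus_iff (hn : d₁ + d₂ = 9) (p : Phase) :
    p ∈ locus d₁ d₂ ↔ 0 ≤ faceW d₁ d₂ p ∧ 0 ≤ faceU d₁ d₂ p ∧ p.2.2 ^ 2 ≤ 1 := by
  simp only [locus, mem_ofPred_eq, faceU, faceW, cast_add_eq_nine hn]
  norm_num
  constructor
  · rintro ⟨h1, h2, h3⟩; exact ⟨by linarith, by linarith, h3⟩
  · rintro ⟨h1, h2, h3⟩; exact ⟨by linarith, by linarith, h3⟩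

theorem continuous_faceU : Continuous (faceU d₁ d₂) := by unfold faceU; fun_prop

theorem continuous_faceW : Continuous (faceW d₁ d₂) := by unfold faceW; fun_prop

theorem isClosed_locus (hn : d₁ + d₂ = 9) : IsClosed (locus d₁ d₂) := by
  have : locus d₁ d₂ = {p | 0 ≤ faceW d₁ d₂ p} ∩ ({p | 0 ≤ faceU d₁ d₂ p} ∩
      {p | p.2.2 ^ 2 ≤ 1}) := by
    ext p; simp [mem_locus_iff hn]
  rw [this]
  exact (isClosed_le continuous_const continuous_faceW).inter
    ((isClosed_le continuous_const continuous_faceU).inter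
      (isClosed_le (by fun_prop) continuous_const))

/-- A point of the frontier of `locus` with `H² < 1` lies on one of the two faces. -/
theorem faceU_eq_zero_or_faceW_eq_zero_of_mem_frontier (hn : d₁ + d₂ = 9) {p : Phase}
    (hp : p ∈ frontier (locus d₁ d₂)) (hH : p.2.2 ^ 2 < 1) :
    faceU d₁ d₂ p = 0 ∨ faceW d₁ d₂ p = 0 := by
  by_contra hcon
  push Not at hcon
  obtain ⟨h1, h2, -⟩ := (mem_locus_iff hn p).1 ((isClosed_locus hn).frontier_subset hp)
  refine hp.2 (mem_interior_iff_mem_nhds.2 ?_)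
  have e1 : ∀ᶠ q in 𝓝 p, 0 < faceW d₁ d₂ q :=
    continuous_faceW.continuousAt.eventually (lt_mem_nhds (lt_of_le_of_ne h1 hcon.2.symm))
  have e2 : ∀ᶠ q in 𝓝 p, 0 < faceU d₁ d₂ q :=
    continuous_faceU.continuousAt.eventually (lt_mem_nhds (lt_of_le_of_ne h2 hcon.1.symm))
  have e3 : ∀ᶠ q : Phase in 𝓝 p, q.2.2 ^ 2 < 1 :=
    (by fun_prop : Continuous fun q : Phase => q.2.2 ^ 2).continuousAt.eventually
      (gt_mem_nhds hH)
  filter_upwards [e1, e2, e3] with q h1 h2 h3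
  exact (mem_locus_iff hn q).2 ⟨h1.le, h2.le, h3.le⟩

theorem abs_le_of_mem_locus (hd₁ : 2 ≤ d₁) (hd₂ : 2 ≤ d₂) (hn : d₁ + d₂ = 9) {p : Phase}
    (hp : p ∈ locus d₁ d₂) : |p.1| ≤ 1 ∧ |p.2.1| ≤ 1 ∧ |p.2.2| ≤ 1 := by
  obtain ⟨h1, h2, h3⟩ := (mem_locus_iff hn p).1 hp
  have hd := fourteen_le_mul hd₁ hd₂ hn
  have h9 := cast_add_eq_nine hn
  have a1 : (2 : ℝ) ≤ d₁ := by exact_mod_cast hd₁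
  have a2 : (2 : ℝ) ≤ d₂ := by exact_mod_cast hd₂
  simp only [faceU, faceW] at h1 h2
  have hΔ := mul_nonneg (by linarith : (0 : ℝ) ≤ d₁ * d₂ - 14) (sq_nonneg p.2.1)
  -- The combination d₂W + d₁U of the face functions eliminates Z.
  have hs : d₁ * d₂ * p.2.1 ^ 2 ≤ 8 := by
    have e1 := mul_nonneg (by linarith : (0 : ℝ) ≤ d₂) h1
    have e2 := mul_nonneg (by linarith : (0 : ℝ) ≤ d₁) h2
    have : (d₁ + d₂ : ℝ) * (8 / 9 - d₁ * d₂ / 9 * p.2.1 ^ 2) ≥ 0 := by linarith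
    rw [h9] at this
    linarith
  refine ⟨abs_le.2 ⟨?_, ?_⟩, (sq_le_one_iff_abs_le_one _).1 (by linarith),
    (sq_le_one_iff_abs_le_one _).1 h3⟩
  · by_contra hc
    nlinarith [sq_nonneg p.2.1]
  · by_contra hc
    nlinarith [sq_nonneg p.2.1]

theorem locus_subset_closedBall (hd₁ : 2 ≤ d₁) (hd₂ : 2 ≤ d₂) (hn : d₁ + d₂ = 9) :
    locus d₁ d₂ ⊆ Metric.closedBall (0 : Phase) 1 := by
  intro p hp
  obtain ⟨h1, h2, h3⟩ := abs_le_of_mem_locus hd₁ hd₂ hn hp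
  rw [mem_closedBall_zero_iff, Prod.norm_def, Prod.norm_def]
  exact max_le h1 (max_le h2 h3)

/-! ### Invariance of the faces and monotonicity of H -/

section Solution

variable {c : ℝ → Phase}

theorem IsSolution.continuous (hc : IsSolution d₁ d₂ c) : Continuous c :=
  continuous_iff_continuousAt.2 fun s => (hc s).continuousAt

theorem IsSolution.hasDerivAt_Z (hc : IsSolution d₁ d₂ c) (hn : d₁ + d₂ = 9) (s : ℝ) :
    HasDerivAt (fun s => (c s).1) (2 / 9 * (c s).2.1 * (d₁ * d₂ * (c s).1 * (c s).2.1 * (c s).2.2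
      + d₁ * d₂ / 9 * (c s).2.1 ^ 2 - 8 / 9 + ((d₁ : ℝ) - d₂) * (c s).1)) s := by
  have h := (ContinuousLinearMap.fst ℝ ℝ (ℝ × ℝ)).hasFDerivAt.comp_hasDerivAt s (hc s)
  convert! h using 1
  simp only [ContinuousLinearMap.coe_fst', field, cast_add_eq_nine hn]
  norm_num

theorem IsSolution.hasDerivAt_Δ (hc : IsSolution d₁ d₂ c) (hn : d₁ + d₂ = 9) (s : ℝ) :
    HasDerivAt (fun s => (c s).2.1) ((c s).2.1 * (c s).2.2 * (d₁ * d₂ / 9 * (c s).2.1 ^ 2 - 8 / 9)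
      + (c s).1) s := by
  have h := ((ContinuousLinearMap.fst ℝ ℝ ℝ).comp
    (ContinuousLinearMap.snd ℝ ℝ (ℝ × ℝ))).hasFDerivAt.comp_hasDerivAt s (hc s)
  convert! h using 1
  simp only [ContinuousLinearMap.coe_comp, Function.comp_apply, ContinuousLinearMap.coe_fst',
    ContinuousLinearMap.coe_snd', field, cast_add_eq_nine hn]
  norm_num

theorem IsSolution.hasDerivAt_H (hc : IsSolution d₁ d₂ c) (hn : d₁ + d₂ = 9) (s : ℝ) :
    HasDerivAt (fun s => (c s).2.2) (-((1 - (c s).2.2 ^ 2) / 9) * (d₁ * d₂ * (c s).2.1 ^ 2 + 1))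
      s := by
  have h := ((ContinuousLinearMap.snd ℝ ℝ ℝ).comp
    (ContinuousLinearMap.snd ℝ ℝ (ℝ × ℝ))).hasFDerivAt.comp_hasDerivAt s (hc s)
  convert! h using 1
  simp only [ContinuousLinearMap.coe_comp, Function.comp_apply,
    ContinuousLinearMap.coe_snd', field, cast_add_eq_nine hn]

/-- The derivative is a multiple of the face function itself, so its sign, and its vanishing,
persist along trajectories. This and its counterpart for `faceW` make `locus` invariant. -/
theorem IsSolution.hasDerivAt_faceU (hc : IsSolution d₁ d₂ c) (hn : d₁ + d₂ = 9) (s : ℝ) :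
    HasDerivAt (fun s => faceU d₁ d₂ (c s))
      (2 * d₂ / 9 * (c s).2.1 * (d₁ * (c s).2.2 * (c s).2.1 - 1) * faceU d₁ d₂ (c s)) s := by
  have h := ((((hc.hasDerivAt_Δ hn s).pow 2).const_mul ((d₁ : ℝ) * d₂ / 9)).const_sub
    (8 / 9)).add ((hc.hasDerivAt_Z hn s).const_mul (d₂ : ℝ))
  convert! h using 1
  have h9 : (d₁ : ℝ) = 9 - d₂ := by linarith [cast_add_eq_nine hn]
  simp only [faceU]
  push_cast
  rw [h9]
  ring

theorem IsSolution.hasDerivAt_faceW (hc : IsSolution d₁ d₂ c) (hn : d₁ + d₂ = 9) (s : ℝ) :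
    HasDerivAt (fun s => faceW d₁ d₂ (c s))
      (2 * d₁ / 9 * (c s).2.1 * (d₂ * (c s).2.2 * (c s).2.1 + 1) * faceW d₁ d₂ (c s)) s := by
  have h := ((((hc.hasDerivAt_Δ hn s).pow 2).const_mul ((d₁ : ℝ) * d₂ / 9)).const_sub
    (8 / 9)).sub ((hc.hasDerivAt_Z hn s).const_mul (d₁ : ℝ))
  convert! h using 1
  have h9 : (d₁ : ℝ) = 9 - d₂ := by linarith [cast_add_eq_nine hn]
  simp only [faceW]
  push_cast
  rw [h9]
  ring

theorem IsSolution.exists_faceU_eq (hc : IsSolution d₁ d₂ c) (hn : d₁ + d₂ = 9) (s₀ s : ℝ) :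
    ∃ e > 0, faceU d₁ d₂ (c s) = faceU d₁ d₂ (c s₀) * e := by
  have := hc.continuous
  exact ⟨_, Real.exp_pos _, eq_mul_exp_integral_of_hasDerivAt (u := fun s => faceU d₁ d₂ (c s))
    (by fun_prop) (hc.hasDerivAt_faceU hn) s₀ s⟩

theorem IsSolution.exists_faceW_eq (hc : IsSolution d₁ d₂ c) (hn : d₁ + d₂ = 9) (s₀ s : ℝ) :
    ∃ e > 0, faceW d₁ d₂ (c s) = faceW d₁ d₂ (c s₀) * e := by
  have := hc.continuous
  exact ⟨_, Real.exp_pos _, eq_mul_exp_integral_of_hasDerivAt (u := fun s => faceW d₁ d₂ (c s))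
    (by fun_prop) (hc.hasDerivAt_faceW hn) s₀ s⟩

theorem IsSolution.exists_one_sub_H_sq_eq (hc : IsSolution d₁ d₂ c) (hn : d₁ + d₂ = 9)
    (s₀ s : ℝ) : ∃ e > 0, 1 - (c s).2.2 ^ 2 = (1 - (c s₀).2.2 ^ 2) * e := by
  have := hc.continuous
  refine ⟨_, Real.exp_pos _, eq_mul_exp_integral_of_hasDerivAt (u := fun s => 1 - (c s).2.2 ^ 2)
    (k := fun s => 2 / 9 * (c s).2.2 * (d₁ * d₂ * (c s).2.1 ^ 2 + 1)) (by fun_prop)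
    (fun s => ?_) s₀ s⟩
  convert! ((hc.hasDerivAt_H hn s).pow 2).const_sub 1 using 1
  push_cast
  ring

theorem IsSolution.mem_locus (hc : IsSolution d₁ d₂ c) (hn : d₁ + d₂ = 9) {s₀ : ℝ}
    (h : c s₀ ∈ locus d₁ d₂) (s : ℝ) : c s ∈ locus d₁ d₂ := by
  obtain ⟨h1, h2, h3⟩ := (mem_locus_iff hn _).1 h
  obtain ⟨e1, he1, q1⟩ := hc.exists_faceW_eq hn s₀ s
  obtain ⟨e2, he2, q2⟩ := hc.exists_faceU_eq hn s₀ s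
  obtain ⟨e3, he3, q3⟩ := hc.exists_one_sub_H_sq_eq hn s₀ s
  have := mul_nonneg (by linarith : 0 ≤ 1 - (c s₀).2.2 ^ 2) he3.le
  exact (mem_locus_iff hn _).2 ⟨q1 ▸ mul_nonneg h1 he1.le, q2 ▸ mul_nonneg h2 he2.le, by linarith⟩

theorem IsSolution.H_mem_Ioo (hc : IsSolution d₁ d₂ c) (hn : d₁ + d₂ = 9) {s₀ : ℝ}
    (h : (c s₀).2.2 ∈ Ioo (-1 : ℝ) 1) (s : ℝ) : (c s).2.2 ∈ Ioo (-1 : ℝ) 1 := by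
  obtain ⟨e, he, q⟩ := hc.exists_one_sub_H_sq_eq hn s₀ s
  have := mul_pos (by nlinarith [h.1, h.2] : 0 < 1 - (c s₀).2.2 ^ 2) he
  exact abs_lt.1 ((sq_lt_one_iff_abs_lt_one _).1 (by linarith))

theorem IsSolution.strictAnti_H (hc : IsSolution d₁ d₂ c) (hn : d₁ + d₂ = 9) {s₀ : ℝ}
    (h : (c s₀).2.2 ∈ Ioo (-1 : ℝ) 1) : StrictAnti fun s => (c s).2.2 := by
  refine strictAnti_of_deriv_neg fun s => ?_
  rw [(hc.hasDerivAt_H hn s).deriv]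
  have h1 := hc.H_mem_Ioo hn h s
  have : 0 < 1 - (c s).2.2 ^ 2 := by nlinarith [h1.1, h1.2]
  have : (0 : ℝ) < d₁ * d₂ * (c s).2.1 ^ 2 + 1 := by positivity
  have := mul_pos (div_pos ‹0 < 1 - (c s).2.2 ^ 2› (by norm_num : (0 : ℝ) < 9)) this
  linarith

theorem IsSolution.comp_add_const (hc : IsSolution d₁ d₂ c) (s₀ : ℝ) :
    IsSolution d₁ d₂ fun s => c (s + s₀) := fun s => (hc (s + s₀)).comp_add_const s s₀

end Solution

/-! ### Dependence on initial values and the cone solution -/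

theorem contDiff_field : ContDiff ℝ 1 (field d₁ d₂) := by
  unfold field
  fun_prop

/-- Solutions in `locus` depend on their initial value in a Lipschitz continuous way. -/
theorem exists_dist_solution_le (hd₁ : 2 ≤ d₁) (hd₂ : 2 ≤ d₂) (hn : d₁ + d₂ = 9) :
    ∃ K : ℝ, ∀ c e : ℝ → Phase, IsSolution d₁ d₂ c → IsSolution d₁ d₂ e → c 0 ∈ locus d₁ d₂ →
      e 0 ∈ locus d₁ d₂ → ∀ s, dist (c s) (e s) ≤ dist (c 0) (e 0) * Real.exp (K * |s|) := by
  obtain ⟨K, hK⟩ := ((contDiff_field (d₁ := d₁)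
    (d₂ := d₂)).locallyLipschitz.locallyLipschitzOn).exists_lipschitzOnWith_of_compact
    (isCompact_closedBall (0 : Phase) 1)
  have hK' : LipschitzOnWith K (field d₁ d₂) (locus d₁ d₂) :=
    hK.mono (locus_subset_closedBall hd₁ hd₂ hn)
  refine ⟨K, fun c e hc he hc0 he0 s => ?_⟩
  rcases le_total 0 s with hs | hs
  · have := dist_le_of_trajectories_ODE_of_mem (v := fun _ => field d₁ d₂)
      (s := fun _ => locus d₁ d₂) (K := K) (f := c) (g := e) (a := 0) (b := s) (δ := dist (c 0) (e 0))
      (fun _ _ => hK') hc.continuous.continuousOn (fun t _ => (hc t).hasDerivWithinAt)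
      (fun t _ => hc.mem_locus hn hc0 t) he.continuous.continuousOn
      (fun t _ => (he t).hasDerivWithinAt) (fun t _ => he.mem_locus hn he0 t) le_rfl s ⟨hs, le_rfl⟩
    rw [sub_zero] at this
    rwa [abs_of_nonneg hs]
  · have hrev : ∀ {c : ℝ → Phase}, IsSolution d₁ d₂ c → ∀ t,
        HasDerivAt (fun t => c (-t)) (-field d₁ d₂ (c (-t))) t := fun hc t => by
      have h := (hc (-t)).scomp t (hasDerivAt_neg t)
      rw [neg_one_smul] at h
      exact h
    have := dist_le_of_trajectories_ODE_of_mem (v := fun _ p => -field d₁ d₂ p)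
      (s := fun _ => locus d₁ d₂) (K := K) (f := fun t => c (-t)) (g := fun t => e (-t))
      (a := 0) (b := -s) (δ := dist (c 0) (e 0))
      (fun _ _ => hK'.neg) (hc.continuous.comp continuous_neg).continuousOn
      (fun t _ => (hrev hc t).hasDerivWithinAt)
      (fun t _ => hc.mem_locus hn hc0 _) (he.continuous.comp continuous_neg).continuousOn
      (fun t _ => (hrev he t).hasDerivWithinAt) (fun t _ => he.mem_locus hn he0 _) (by simp)
      (-s) ⟨by linarith, le_rfl⟩
    rw [abs_of_nonpos hs]
    simpa using this

theorem IsSolution.eq_of_eq (hd₁ : 2 ≤ d₁) (hd₂ : 2 ≤ d₂) (hn : d₁ + d₂ = 9) {c e : ℝ → Phase}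
    (hc : IsSolution d₁ d₂ c) (he : IsSolution d₁ d₂ e) {s₀ s₁ : ℝ} (h0 : c s₀ ∈ locus d₁ d₂)
    (h : c s₀ = e s₁) (s : ℝ) : c (s + s₀) = e (s + s₁) := by
  obtain ⟨K, hK⟩ := exists_dist_solution_le hd₁ hd₂ hn
  have := hK _ _ (hc.comp_add_const s₀) (he.comp_add_const s₁) (by simpa using h0)
    (by simpa [← h] using h0) s
  simp only [zero_add, h, dist_self, zero_mul] at this
  exact dist_le_zero.1 this

/-- The cone solution. -/
noncomputable def coneSolution (s : ℝ) : Phase := (0, 0, -Real.tanh (s / 9))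

theorem isSolution_coneSolution (hn : d₁ + d₂ = 9) : IsSolution d₁ d₂ coneSolution := by
  intro s
  have h := ((hasDerivAt_tanh (s / 9)).scomp s ((hasDerivAt_id s).div_const 9)).neg
  have := (hasDerivAt_const s (0 : ℝ)).prodMk ((hasDerivAt_const s (0 : ℝ)).prodMk h)
  convert! this using 1
  simp [field, coneSolution, cast_add_eq_nine hn]
  ring

theorem coneSolution_zero_mem_locus (hn : d₁ + d₂ = 9) : coneSolution 0 ∈ locus d₁ d₂ := by
  rw [mem_locus_iff hn]
  simp [coneSolution, faceU, faceW]
  norm_num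

/-- A trajectory that meets the axis `Z = Δ = 0` stays on it. -/
theorem IsSolution.eq_zero_of_eq_zero (hd₁ : 2 ≤ d₁) (hd₂ : 2 ≤ d₂) (hn : d₁ + d₂ = 9)
    {c : ℝ → Phase} (hc : IsSolution d₁ d₂ c) {s₀ : ℝ} (hH : (c s₀).2.2 ∈ Ioo (-1 : ℝ) 1)
    (hZ : (c s₀).1 = 0) (hΔ : (c s₀).2.1 = 0) (s : ℝ) : (c s).1 = 0 ∧ (c s).2.1 = 0 := by
  have h : coneSolution (-9 * Real.artanh (c s₀).2.2) = c s₀ := by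
    rw [coneSolution, show -9 * Real.artanh (c s₀).2.2 / 9 = -Real.artanh (c s₀).2.2 by ring,
      Real.tanh_neg, neg_neg, Real.tanh_artanh hH, ← hZ, Prod.mk.injEq, Prod.mk.injEq]
    exact ⟨rfl, by rw [hΔ, hZ], rfl⟩
  have := IsSolution.eq_of_eq hd₁ hd₂ hn (isSolution_coneSolution hn) hc
    ((isSolution_coneSolution hn).mem_locus hn (coneSolution_zero_mem_locus hn) _) h (s - s₀)
  rw [sub_add_cancel] at this
  rw [← this]
  exact ⟨rfl, rfl⟩

/-! ### Trajectories in the unstable manifold -/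

/-- Serves to keep the angle above -π/2 by excluding that single value, both along a trajectory and
along a range of parameters τ. -/
theorem IsPreconnected.lt_of_forall_ne {X : Type*} [TopologicalSpace X] {S : Set X} {f : X → ℝ}
    {v : ℝ} (hS : IsPreconnected S) (hf : ContinuousOn f S) {x : X} (hx : x ∈ S) (hv : v < f x)
    (hne : ∀ y ∈ S, f y ≠ v) : ∀ y ∈ S, v < f y := by
  intro y hy
  by_contra h
  obtain ⟨z, hz, hzv⟩ := hS.intermediate_value hy hx hf ⟨not_lt.1 h, hv.le⟩
  exact hne z hz hzv

theorem hasDerivAt_pow_of_linear {u : ℝ → ℝ} {k s : ℝ} (h : HasDerivAt u (k * u s) s) (m : ℕ) :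
    HasDerivAt (fun s => u s ^ m) (m * k * u s ^ m) s := by
  convert! h.pow m using 1
  rcases m with _ | m
  · simp
  · simp only [Nat.add_sub_cancel]; ring

/-- A normalized power of the volume times scalar curvature functional, which is monotone along
trajectories. -/
noncomputable def lyapunov (d₁ d₂ : ℕ) (p : Phase) : ℝ :=
  faceU d₁ d₂ p ^ d₁ * faceW d₁ d₂ p ^ d₂

theorem continuous_lyapunov : Continuous (lyapunov d₁ d₂) :=
  (continuous_faceU.pow _).mul (continuous_faceW.pow _)

section Solution

variable {c : ℝ → Phase}

/-- The exponents d₁ and d₂ are chosen so that the terms linear in Δ cancel, leaving a factor with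
the sign of H. -/
theorem IsSolution.hasDerivAt_lyapunov (hc : IsSolution d₁ d₂ c) (hn : d₁ + d₂ = 9) (s : ℝ) :
    HasDerivAt (fun s => lyapunov d₁ d₂ (c s))
      (2 * d₁ * d₂ * (c s).2.2 * (c s).2.1 ^ 2 * lyapunov d₁ d₂ (c s)) s := by
  have h := (hasDerivAt_pow_of_linear (hc.hasDerivAt_faceU hn s) d₁).mul
    (hasDerivAt_pow_of_linear (hc.hasDerivAt_faceW hn s) d₂)
  convert! h using 1
  have h9 : (d₁ : ℝ) = 9 - d₂ := by linarith [cast_add_eq_nine hn]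
  simp only [lyapunov]
  rw [h9]
  ring

theorem IsSolution.lyapunov_le (hc : IsSolution d₁ d₂ c) (hn : d₁ + d₂ = 9)
    (hloc : c 0 ∈ locus d₁ d₂) {s s₁ : ℝ} (hs : s ≤ s₁) (hH : ∀ t ≤ s₁, 0 ≤ (c t).2.2) :
    lyapunov d₁ d₂ (c s) ≤ lyapunov d₁ d₂ (c s₁) := by
  refine monotoneOn_of_deriv_nonneg (f := fun s => lyapunov d₁ d₂ (c s)) (convex_Iic s₁)
    (continuous_lyapunov.comp hc.continuous).continuousOn
    (fun t _ => (hc.hasDerivAt_lyapunov hn t).differentiableAt.differentiableWithinAt) ?_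
    hs (mem_Iic.2 le_rfl) hs
  intro t ht
  rw [interior_Iic] at ht
  rw [(hc.hasDerivAt_lyapunov hn t).deriv]
  obtain ⟨h1, h2, -⟩ := (mem_locus_iff hn _).1 (hc.mem_locus hn hloc t)
  have := hH t (le_of_lt ht)
  have : 0 ≤ lyapunov d₁ d₂ (c t) := mul_nonneg (pow_nonneg h2 _) (pow_nonneg h1 _)
  positivity

/-- A trajectory in the unstable manifold of `p₁⁺` does not pass through the half plane
`Z = 0`, `Δ < 0` as long as it is close to `p₁⁺` in terms of `lyapunov`. -/
theorem IsSolution.not_Z_eq_zero_and_Δ_neg (hd₁ : 2 ≤ d₁) (hd₂ : 2 ≤ d₂) (hn : d₁ + d₂ = 9)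
    (hc : IsSolution d₁ d₂ c) (hloc : c 0 ∈ locus d₁ d₂)
    (hlim : Tendsto c atBot (𝓝 (p₁plus d₁))) {s s₁ : ℝ} (hs : s ≤ s₁)
    (hH : ∀ t ≤ s₁, 3 / 4 ≤ (c t).2.2)
    (hG : lyapunov d₁ d₂ (c s₁) < (8 / 9 - d₁ * d₂ / 9 * (7 / (5 * d₂)) ^ 2) ^ 9) :
    ¬ ((c s).1 = 0 ∧ (c s).2.1 < 0) := by
  rintro ⟨hZ, hΔ⟩
  have a1 : (2 : ℝ) ≤ d₁ := by exact_mod_cast hd₁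
  have a2 : (2 : ℝ) ≤ d₂ := by exact_mod_cast hd₂
  have h9 := cast_add_eq_nine hn
  have hd2 : (0 : ℝ) < d₂ := by linarith
  -- Two demands fix κ: κ d₂ · 3/4 = 21/20 > 1, used at Δ = -κ below, and A > 0, which amounts to
  -- 200 d₂ > 49 d₁ and holds since d₂ ≥ 2 and d₁ ≤ 7.
  set κ : ℝ := 7 / (5 * d₂) with hκ
  have hκ0 : 0 < κ := by positivity
  have hκd : κ * d₂ = 7 / 5 := by rw [hκ]; field_simp
  set A : ℝ := 8 / 9 - d₁ * d₂ / 9 * κ ^ 2 with hA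
  have hA0 : 0 < A := by
    have : A * (225 * d₂) = 200 * d₂ - 49 * d₁ := by
      rw [hA]; linear_combination (-25 * d₁ * κ * d₂ - 35 * d₁) * hκd
    by_contra hcon
    nlinarith
  -- At Z = 0 both face functions coincide and d₁ + d₂ = 9, so the bound becomes a comparison of
  -- ninth powers and yields Δ < -κ.
  have hG' := (hc.lyapunov_le hn hloc hs fun t ht => by linarith [hH t ht]).trans_lt hG
  rw [lyapunov, show faceU d₁ d₂ (c s) = 8 / 9 - d₁ * d₂ / 9 * (c s).2.1 ^ 2 by
    rw [faceU, hZ]; ring, show faceW d₁ d₂ (c s) = 8 / 9 - d₁ * d₂ / 9 * (c s).2.1 ^ 2 by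
    rw [faceW, hZ]; ring, ← pow_add, hn] at hG'
  have hlt := lt_of_pow_lt_pow_left₀ 9 hA0.le hG'
  have hsq : κ ^ 2 < (c s).2.1 ^ 2 := by
    have := fourteen_le_mul hd₁ hd₂ hn
    by_contra hcon
    nlinarith
  have hΔκ : (c s).2.1 + κ < 0 := by nlinarith
  -- At Δ = -κ, `faceU` ≥ 0 gives d₂Z ≥ -A, while the other term of d₂Δ' is (7/5) H A ≥ (21/20) A.
  -- Hence Δ' > 0, and Δ < -κ persists backwards in time.
  have hall : ∀ r ≤ s, (c r).2.1 + κ < 0 := by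
    intro r hr
    refine neg_of_forall_zero_hasDerivAt_pos (f := fun r => (c r).2.1 + κ) (a := r) (b := s)
      (fun t _ => ((hc.hasDerivAt_Δ hn t).add_const κ).continuousAt.continuousWithinAt) hΔκ
      (fun t ht h0 => ⟨_, ?_, (hc.hasDerivAt_Δ hn t).add_const κ⟩) r ⟨le_rfl, hr⟩
    have h0' : (c t).2.1 = -κ := by linarith
    have hHt := hH t (ht.2.trans hs)
    have hU := ((mem_locus_iff hn _).1 (hc.mem_locus hn hloc t)).2.1
    rw [faceU, h0', neg_sq, ← hA] at hU
    rw [h0', neg_sq]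
    have e : d₂ * (-κ * (c t).2.2 * (d₁ * d₂ / 9 * κ ^ 2 - 8 / 9) + (c t).1)
        = 7 / 5 * (c t).2.2 * A + d₂ * (c t).1 := by
      rw [hA]; linear_combination (c t).2.2 * (8 / 9 - d₁ * d₂ / 9 * κ ^ 2) * hκd
    have : 0 < d₂ * (-κ * (c t).2.2 * (d₁ * d₂ / 9 * κ ^ 2 - 8 / 9) + (c t).1) := by
      rw [e]; nlinarith
    exact pos_of_mul_pos_right this hd2.le
  have hlimΔ : Tendsto (fun s => (c s).2.1) atBot (𝓝 (1 / d₁)) :=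
    ((continuous_fst.comp continuous_snd).tendsto _).comp hlim
  have h1 : (0 : ℝ) < 1 / d₁ := by positivity
  obtain ⟨r, hr1, hr2⟩ := ((hlimΔ.eventually (lt_mem_nhds h1)).and (eventually_le_atBot s)).exists
  linarith [hall r hr2]

end Solution

/-! ### Trajectories through the initial slice curve -/

/-- `c` is the trajectory through `γ 0 τ`. -/
structure IsTrajectoryThrough (d₁ d₂ : ℕ) (γ : ℝ → ℝ → Phase) (τ : ℝ) (c : ℝ → Phase) : Prop where
  isSolution : IsSolution d₁ d₂ c
  zero : c 0 = γ 0 τ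
  mem_locus : c 0 ∈ locus d₁ d₂
  H_zero : (c 0).2.2 = 0
  follows : ∀ s, γ (c s).2.2 τ = c s

theorem IsTrajectoryThrough.H_mem_Ioo (hn : d₁ + d₂ = 9) {γ : ℝ → ℝ → Phase} {τ : ℝ}
    {c : ℝ → Phase} (hc : IsTrajectoryThrough d₁ d₂ γ τ c) (s : ℝ) :
    (c s).2.2 ∈ Ioo (-1 : ℝ) 1 :=
  hc.isSolution.H_mem_Ioo hn (s₀ := 0) (by rw [hc.H_zero]; norm_num) s

theorem IsTrajectoryThrough.strictAnti_H (hn : d₁ + d₂ = 9) {γ : ℝ → ℝ → Phase} {τ : ℝ}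
    {c : ℝ → Phase} (hc : IsTrajectoryThrough d₁ d₂ γ τ c) : StrictAnti fun s => (c s).2.2 :=
  hc.isSolution.strictAnti_H hn (hc.H_mem_Ioo hn 0)

section SliceFamily

variable {a b : ℝ} {γ : ℝ → ℝ → Phase} {φ : ℝ → ℝ → ℝ}

theorem IsSliceFamily.mem_locus (hn : d₁ + d₂ = 9) (hS : IsSliceFamily d₁ d₂ a b γ) {τ : ℝ}
    (hτ : τ ∈ Ico (-b) 0) : γ 0 τ ∈ locus d₁ d₂ := by
  rcases le_total τ (-a) with h | h
  · exact (isClosed_locus hn).frontier_subset (hS.mem_boundary τ ⟨hτ.1, h⟩).1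
  · exact (hS.parametrizes.mapsTo ⟨h, hτ.2⟩).1.1

/-- The slice family supplies a possibly different trajectory for every h. Uniqueness merges them
into one, and strict monotonicity of H identifies the point on each slice. -/
theorem IsSliceFamily.exists_trajectory (hd₁ : 2 ≤ d₁) (hd₂ : 2 ≤ d₂) (hn : d₁ + d₂ = 9)
    (hS : IsSliceFamily d₁ d₂ a b γ) {τ : ℝ} (hτ : τ ∈ Ico (-b) 0) :
    ∃ c, IsTrajectoryThrough d₁ d₂ γ τ c := by
  obtain ⟨hsl, c, hc, ⟨s₀, hs₀⟩, -⟩ := hS.follows 0 (by norm_num) τ hτ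
  have hsol := hc.comp_add_const s₀
  have hmem := hS.mem_locus hn hτ
  have hH0 : (c (0 + s₀)).2.2 = 0 := by rw [zero_add, hs₀]; exact hsl
  have hIoo := hsol.H_mem_Ioo hn (s₀ := 0) (by rw [hH0]; norm_num)
  refine ⟨fun s => c (s + s₀), hsol, by simpa using hs₀, by simpa [hs₀] using hmem, hH0, ?_⟩
  intro s
  obtain ⟨hsl', e, he, ⟨s₁, hs₁⟩, s₂, hs₂⟩ := hS.follows _ (hIoo s) τ hτ
  have heq := hsol.eq_of_eq hd₁ hd₂ hn he (s₀ := 0) (s₁ := s₁) (by simpa [hs₀] using hmem)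
    (by simp [hs₀, hs₁]) (s₂ - s₁)
  rw [sub_add_cancel, hs₂, add_zero] at heq
  rw [← heq] at hsl' ⊢
  have := (hsol.strictAnti_H hn (hIoo 0)).injective hsl'
  rw [this]

theorem IsSliceFamily.tendsto_p₁plus (hd₁ : 2 ≤ d₁) (hd₂ : 2 ≤ d₂) (hn : d₁ + d₂ = 9)
    (hS : IsSliceFamily d₁ d₂ a b γ) {τ : ℝ} (hτ : τ ∈ Ico (-a) 0) {c : ℝ → Phase}
    (hc : IsTrajectoryThrough d₁ d₂ γ τ c) : Tendsto c atBot (𝓝 (p₁plus d₁)) := by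
  obtain ⟨e, he, he0, hlim⟩ := (hS.parametrizes.mapsTo hτ).1.2
  have : c = e := by
    funext s
    simpa using hc.isSolution.eq_of_eq hd₁ hd₂ hn he hc.mem_locus (hc.zero.trans he0.symm) s
  rwa [this]

/-- The axis Z = Δ = 0 is invariant, but Δ tends to 1/d₁ > 0 in backward time. -/
theorem IsSliceFamily.ne_zero (hd₁ : 2 ≤ d₁) (hd₂ : 2 ≤ d₂) (hn : d₁ + d₂ = 9)
    (hS : IsSliceFamily d₁ d₂ a b γ) {τ : ℝ} (hτ : τ ∈ Ico (-a) 0) {c : ℝ → Phase}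
    (hc : IsTrajectoryThrough d₁ d₂ γ τ c) (s : ℝ) : (c s).1 ≠ 0 ∨ (c s).2.1 ≠ 0 := by
  by_contra hcon
  push Not at hcon
  have hlimΔ : Tendsto (fun s => (c s).2.1) atBot (𝓝 (1 / d₁)) :=
    ((continuous_fst.comp continuous_snd).tendsto _).comp
      (hS.tendsto_p₁plus hd₁ hd₂ hn hτ hc)
  have h1 : (0 : ℝ) < 1 / d₁ := by
    have : (2 : ℝ) ≤ d₁ := by exact_mod_cast hd₁
    positivity
  obtain ⟨r, hr⟩ := (hlimΔ.eventually (lt_mem_nhds h1)).exists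
  exact hr.ne' (hc.isSolution.eq_zero_of_eq_zero hd₁ hd₂ hn (hc.H_mem_Ioo hn s) hcon.1 hcon.2 r).2

theorem IsAngle.isPolarAngle (hn : d₁ + d₂ = 9) (hφ : IsAngle b γ φ) {τ : ℝ}
    (hτ : τ ∈ Ico (-b) 0) {c : ℝ → Phase} (hc : IsTrajectoryThrough d₁ d₂ γ τ c) (s : ℝ) :
    IsPolarAngle ((c s).1, (c s).2.1) (φ (c s).2.2 τ) := by
  have := hφ.polar _ (hc.H_mem_Ioo hn s) τ hτ
  rwa [hc.follows s] at this

theorem IsAngle.continuous_comp (hn : d₁ + d₂ = 9) (hφ : IsAngle b γ φ) {τ : ℝ}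
    (hτ : τ ∈ Ico (-b) 0) {c : ℝ → Phase} (hc : IsTrajectoryThrough d₁ d₂ γ τ c) :
    Continuous fun s => φ (c s).2.2 τ := by
  have hcont := hc.isSolution.continuous
  exact hφ.continuousOn.comp_continuous (f := fun s => ((c s).2.2, τ)) (by fun_prop)
    fun s => ⟨hc.H_mem_Ioo hn s, hτ⟩

/-- At the start of the unstable manifold the angle exceeds `-π/2`. -/
theorem IsAngle.start_gt (hn : d₁ + d₂ = 9) (hS : IsSliceFamily d₁ d₂ a b γ)
    (hφ : IsAngle b γ φ) {c : ℝ → Phase} (hc : IsTrajectoryThrough d₁ d₂ γ (-a) c) (s : ℝ) :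
    -(Real.pi / 2) < φ (c s).2.2 (-a) := by
  have ha := hS.a_pos
  have hab := hS.a_lt_b
  have hma : -a ∈ Ico (-b) 0 := ⟨by linarith, by linarith⟩
  have hcos : ∀ τ ∈ Ioc (-b) (-a), 0 < Real.cos (φ 0 τ) := by
    intro τ hτ
    have hp := (hφ.polar 0 (by norm_num) τ ⟨hτ.1.le, by linarith [hτ.2]⟩).1
    have hZ := hS.half_plane τ hτ
    simp only [toPlane] at hp
    rw [hp] at hZ
    exact pos_of_mul_pos_right hZ (Real.sqrt_nonneg _)
  have hφ0 : ContinuousOn (φ 0) (Icc (-b) (-a)) :=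
    hφ.continuousOn.comp (f := fun τ => ((0 : ℝ), τ)) (by fun_prop)
      fun τ hτ => ⟨by norm_num, hτ.1, by linarith [hτ.2]⟩
  have hpi := Real.pi_pos
  -- The cosine is positive on the boundary arc after its start. An end angle at most -π/2 would
  -- therefore lie below -π, and the angle would have to pass -π, where the cosine is -1.
  have h0 : -(Real.pi / 2) < φ 0 (-a) := by
    by_contra hcon
    have h1 : φ 0 (-a) < -Real.pi := by
      by_contra hcon'
      have := Real.cos_nonpos_of_pi_div_two_le_of_le (x := -φ 0 (-a)) (by linarith) (by linarith)
      rw [Real.cos_neg] at this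
      linarith [hcos (-a) ⟨by linarith, le_rfl⟩]
    obtain ⟨τ, hτ, hτπ⟩ := intermediate_value_Icc' (by linarith) hφ0
      (show -Real.pi ∈ _ from ⟨h1.le, by rw [hφ.normalized]; linarith⟩)
    have hτb : -b < τ := lt_of_le_of_ne hτ.1 (by
      rintro rfl; rw [hφ.normalized] at hτπ; linarith)
    have := hcos τ ⟨hτb, hτ.2⟩
    rw [hτπ, Real.cos_neg, Real.cos_pi] at this
    linarith
  have hZ0 : 0 < (c 0).1 := by rw [hc.zero]; exact hS.half_plane _ ⟨by linarith, le_rfl⟩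
  have hd1 : (0 : ℝ) ≤ d₁ := Nat.cast_nonneg _
  have hd2 : (0 : ℝ) ≤ d₂ := Nat.cast_nonneg _
  have h9 := cast_add_eq_nine hn
  have hdiff : ∀ p, faceU d₁ d₂ p - faceW d₁ d₂ p = 9 * p.1 := fun p => by
    simp only [faceU, faceW]; linear_combination p.1 * h9
  -- Since U - W = 9Z > 0 and W ≥ 0, the boundary point can only lie on the face W = 0. That face is
  -- invariant and U > 0 persists, so Z > 0 along the whole trajectory.
  have hW0 : faceW d₁ d₂ (c 0) = 0 := by
    have hb := hS.mem_boundary (-a) ⟨by linarith, le_rfl⟩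
    rw [← hc.zero] at hb
    rcases faceU_eq_zero_or_faceW_eq_zero_of_mem_frontier hn hb.1 (by rw [hc.H_zero]; norm_num)
      with h | h
    · have := ((mem_locus_iff hn _).1 hc.mem_locus).1
      linarith [hdiff (c 0)]
    · exact h
  have hZ : ∀ s, 0 < (c s).1 := by
    intro s
    obtain ⟨e1, he1, q1⟩ := hc.isSolution.exists_faceU_eq hn 0 s
    obtain ⟨e2, he2, q2⟩ := hc.isSolution.exists_faceW_eq hn 0 s
    rw [hW0, zero_mul] at q2
    have : 0 < faceU d₁ d₂ (c s) := by
      rw [q1]; exact mul_pos (by linarith [hdiff (c 0)]) he1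
    linarith [hdiff (c s)]
  refine IsPreconnected.lt_of_forall_ne (f := fun s => φ (c s).2.2 (-a)) isPreconnected_univ
    (hφ.continuous_comp hn hma hc).continuousOn (mem_univ 0) (by simpa only [hc.H_zero] using h0)
    (fun y _ hy => ?_) s (mem_univ s)
  have hp := (hφ.isPolarAngle hn hma hc y).1
  simp only at hp hy
  rw [hy, Real.cos_neg, Real.cos_pi_div_two, mul_zero] at hp
  exact (hZ y).ne' hp

end SliceFamily

/-! ### Comparison of the angle with the barrier angle -/

section SliceFamily

variable {a b : ℝ} {γ : ℝ → ℝ → Phase} {φ : ℝ → ℝ → ℝ}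

/-- The Lipschitz estimate in the initial value transfers continuity of `γ 0` to every fixed time.
-/
theorem IsSliceFamily.continuousOn_trajectory (hd₁ : 2 ≤ d₁) (hd₂ : 2 ≤ d₂) (hn : d₁ + d₂ = 9)
    (hS : IsSliceFamily d₁ d₂ a b γ) {c : ℝ → ℝ → Phase}
    (hc : ∀ τ ∈ Ico (-b) 0, IsTrajectoryThrough d₁ d₂ γ τ (c τ)) (s : ℝ) :
    ContinuousOn (fun τ => c τ s) (Ico (-b) 0) := by
  obtain ⟨K, hK⟩ := exists_dist_solution_le hd₁ hd₂ hn
  intro τ hτ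
  have h1 : Tendsto (fun t => dist (γ 0 t) (γ 0 τ) * Real.exp (K * |s|)) (𝓝[Ico (-b) 0] τ)
      (𝓝 0) := by
    have := (tendsto_iff_dist_tendsto_zero.1 (hS.continuousOn_zero τ hτ)).mul_const
      (Real.exp (K * |s|))
    rwa [zero_mul] at this
  refine tendsto_iff_dist_tendsto_zero.2 (squeeze_zero' (Eventually.of_forall fun _ =>
    dist_nonneg) ?_ h1)
  filter_upwards [self_mem_nhdsWithin] with t ht
  have := hK _ _ (hc t ht).isSolution (hc τ hτ).isSolution (hc t ht).mem_locus
    (hc τ hτ).mem_locus s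
  rwa [(hc t ht).zero, (hc τ hτ).zero] at this

theorem IsSliceFamily.Ico_subset (hS : IsSliceFamily d₁ d₂ a b γ) :
    Ico (-a) 0 ⊆ Ico (-b) 0 :=
  Ico_subset_Ico_left (by linarith [hS.a_lt_b])

/-- Trajectories of the unstable manifold are uniformly close to `p₁⁺` for compact sets of
parameters. -/
theorem IsSliceFamily.exists_uniform_time (hd₁ : 2 ≤ d₁) (hd₂ : 2 ≤ d₂) (hn : d₁ + d₂ = 9)
    (hS : IsSliceFamily d₁ d₂ a b γ) {c : ℝ → ℝ → Phase}
    (hc : ∀ τ ∈ Ico (-b) 0, IsTrajectoryThrough d₁ d₂ γ τ (c τ)) {g₀ : ℝ} (hg₀ : 0 < g₀)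
    {S : Set ℝ} (hcpt : IsCompact S) (hsub : S ⊆ Ico (-a) 0) :
    ∃ s₀ ≤ 0, ∀ τ ∈ S, lyapunov d₁ d₂ (c τ s₀) < g₀ ∧ 3 / 4 < (c τ s₀).2.2 := by
  -- Both conditions persist to earlier times, since for s ≤ 0 one has H ≥ 0, `lyapunov` is
  -- nondecreasing and H decreases. Hence the times of finitely many neighbourhoods can be replaced
  -- by their minimum.
  have hmono : ∀ τ ∈ Ico (-a) 0, ∀ s ≤ 0, ∀ r ≤ s,
      lyapunov d₁ d₂ (c τ s) < g₀ ∧ 3 / 4 < (c τ s).2.2 →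
      lyapunov d₁ d₂ (c τ r) < g₀ ∧ 3 / 4 < (c τ r).2.2 := by
    intro τ hτ s hs r hr ⟨h1, h2⟩
    have hcτ := hc τ (hS.Ico_subset hτ)
    have hanti := (hcτ.strictAnti_H hn).antitone
    refine ⟨(hcτ.isSolution.lyapunov_le hn hcτ.mem_locus hr fun t ht => ?_).trans_lt h1,
      h2.trans_le (hanti hr)⟩
    exact hcτ.H_zero.symm.le.trans (hanti (ht.trans hs))
  have key : ∃ s₀ ≤ 0, ∀ τ ∈ S ∩ Ico (-a) 0,
      lyapunov d₁ d₂ (c τ s₀) < g₀ ∧ 3 / 4 < (c τ s₀).2.2 := by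
    refine hcpt.induction_on (p := fun S => ∃ s₀ ≤ 0, ∀ τ ∈ S ∩ Ico (-a) 0,
      lyapunov d₁ d₂ (c τ s₀) < g₀ ∧ 3 / 4 < (c τ s₀).2.2) ⟨0, le_rfl, by simp⟩ ?_ ?_ ?_
    · rintro s t hst ⟨s₀, h0, h⟩
      exact ⟨s₀, h0, fun τ hτ => h τ ⟨hst hτ.1, hτ.2⟩⟩
    · rintro s t ⟨s₀, h0, h⟩ ⟨s₁, h1, h'⟩
      refine ⟨min s₀ s₁, (min_le_left _ _).trans h0, ?_⟩
      rintro τ ⟨hτ | hτ, hτ'⟩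
      · exact hmono τ hτ' s₀ h0 _ (min_le_left _ _) (h τ ⟨hτ, hτ'⟩)
      · exact hmono τ hτ' s₁ h1 _ (min_le_right _ _) (h' τ ⟨hτ, hτ'⟩)
    · intro τ hτ
      have hτa := hsub hτ
      have hlim := hS.tendsto_p₁plus hd₁ hd₂ hn hτa (hc τ (hS.Ico_subset hτa))
      have hW : lyapunov d₁ d₂ (p₁plus d₁) = 0 := by
        have h0 : faceW d₁ d₂ (p₁plus d₁) = 0 := by
          have : (d₁ : ℝ) ≠ 0 := by positivity
          have h9 : (d₂ : ℝ) = 9 - d₁ := by linarith [cast_add_eq_nine hn]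
          simp only [faceW, p₁plus, h9]
          field_simp
          ring
        rw [lyapunov, h0, zero_pow (by omega), mul_zero]
      have e1 := ((continuous_lyapunov (d₁ := d₁) (d₂ := d₂)).tendsto (p₁plus d₁)).comp hlim
      rw [hW] at e1
      have e2 : Tendsto (fun s => (c τ s).2.2) atBot (𝓝 1) :=
        ((continuous_snd.comp continuous_snd).tendsto (p₁plus d₁)).comp hlim
      obtain ⟨s₀, ⟨hs1, hs2⟩, hs0⟩ := ((e1.eventually (gt_mem_nhds hg₀)).and
        (e2.eventually (lt_mem_nhds (by norm_num : (3 / 4 : ℝ) < 1)))|>.and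
          (eventually_le_atBot 0)).exists
      have hcont := (hS.continuousOn_trajectory hd₁ hd₂ hn hc s₀).mono hS.Ico_subset τ hτa
      have ev : ∀ᶠ t in 𝓝[Ico (-a) 0] τ,
          lyapunov d₁ d₂ (c t s₀) < g₀ ∧ 3 / 4 < (c t s₀).2.2 :=
        ((continuous_lyapunov.continuousAt.comp_continuousWithinAt hcont).eventually
          (gt_mem_nhds hs1)).and
          (((continuous_snd.comp continuous_snd).continuousAt.comp_continuousWithinAt
            hcont).eventually (lt_mem_nhds hs2))
      exact ⟨_, nhdsWithin_mono τ hsub ev, s₀, hs0, fun t ht => ht.1⟩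
  obtain ⟨s₀, h0, h⟩ := key
  exact ⟨s₀, h0, fun τ hτ => h τ ⟨hτ, hsub hτ⟩⟩

theorem IsAngle.hasDerivAt_comp (hd₁ : 2 ≤ d₁) (hd₂ : 2 ≤ d₂) (hn : d₁ + d₂ = 9)
    (hS : IsSliceFamily d₁ d₂ a b γ) (hφ : IsAngle b γ φ) {τ : ℝ} (hτ : τ ∈ Ico (-a) 0)
    {c : ℝ → Phase} (hc : IsTrajectoryThrough d₁ d₂ γ τ c) (s : ℝ) :
    HasDerivAt (fun s => φ (c s).2.2 τ)
      (((c s).1 * ((c s).2.1 * (c s).2.2 * (d₁ * d₂ / 9 * (c s).2.1 ^ 2 - 8 / 9) + (c s).1)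
        - (c s).2.1 * (2 / 9 * (c s).2.1 * (d₁ * d₂ * (c s).1 * (c s).2.1 * (c s).2.2
          + d₁ * d₂ / 9 * (c s).2.1 ^ 2 - 8 / 9 + ((d₁ : ℝ) - d₂) * (c s).1)))
        / ((c s).1 ^ 2 + (c s).2.1 ^ 2)) s :=
  hasDerivAt_of_isPolarAngle (hφ.continuous_comp hn (hS.Ico_subset hτ) hc).continuousAt
    (hc.isSolution.hasDerivAt_Z hn s) (hc.isSolution.hasDerivAt_Δ hn s)
    (hS.ne_zero hd₁ hd₂ hn hτ hc s)
    (Eventually.of_forall fun t => hφ.isPolarAngle hn (hS.Ico_subset hτ) hc t)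

/-- On the unstable manifold of `p₁⁺` the angle is positive. -/
theorem IsAngle.pos (hd₁ : 2 ≤ d₁) (hd₂ : 2 ≤ d₂) (hn : d₁ + d₂ = 9)
    (hS : IsSliceFamily d₁ d₂ a b γ) (hφ : IsAngle b γ φ) {c : ℝ → ℝ → Phase}
    (hc : ∀ τ ∈ Ico (-b) 0, IsTrajectoryThrough d₁ d₂ γ τ (c τ)) {τ : ℝ} (hτ : τ ∈ Ico (-a) 0)
    (s : ℝ) : 0 < φ (c τ s).2.2 τ := by
  have a1 : (2 : ℝ) ≤ d₁ := by exact_mod_cast hd₁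
  have a2 : (2 : ℝ) ≤ d₂ := by exact_mod_cast hd₂
  have hd2 : (0 : ℝ) < d₂ := by linarith
  have hpi := Real.pi_pos
  have hg : (0 : ℝ) < (8 / 9 - d₁ * d₂ / 9 * (7 / (5 * d₂)) ^ 2) ^ 9 := by
    refine pow_pos ?_ 9
    have e : 8 / 9 - (d₁ : ℝ) * d₂ / 9 * (7 / (5 * d₂)) ^ 2
        = (200 * d₂ - 49 * d₁) / (225 * d₂) := by field_simp; ring
    rw [e]
    exact div_pos (by linarith [cast_add_eq_nine hn]) (by positivity)
  have hsub : Icc (-a) τ ⊆ Ico (-a) 0 := fun t ht => ⟨ht.1, ht.2.trans_lt hτ.2⟩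
  obtain ⟨s₀, hs₀, hclose⟩ := hS.exists_uniform_time hd₁ hd₂ hn hc hg isCompact_Icc hsub
  -- The angle -π/2 means Z = 0 and Δ < 0, which is excluded before the uniform time. The bound can
  -- thus be moved from -a to τ at time s₀, and then back in time towards p₁⁺.
  have hne : ∀ t ∈ Icc (-a) τ, ∀ r ≤ s₀, φ (c t r).2.2 t ≠ -(Real.pi / 2) := by
    intro t ht r hr heq
    have hct := hc t (hS.Ico_subset (hsub ht))
    have hp := hφ.isPolarAngle hn (hS.Ico_subset (hsub ht)) hct r
    have hanti := (hct.strictAnti_H hn).antitone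
    refine hct.isSolution.not_Z_eq_zero_and_Δ_neg hd₁ hd₂ hn hct.mem_locus
      (hS.tendsto_p₁plus hd₁ hd₂ hn (hsub ht) hct) hr
      (fun q hq => (hclose t ht).2.le.trans (hanti hq)) (hclose t ht).1 ?_
    obtain ⟨hp1, hp2⟩ := hp
    simp only at hp1 hp2
    rw [heq, Real.cos_neg, Real.cos_pi_div_two, mul_zero] at hp1
    rw [heq, Real.sin_neg, Real.sin_pi_div_two, mul_neg, mul_one] at hp2
    refine ⟨hp1, lt_of_le_of_ne ?_ ((hS.ne_zero hd₁ hd₂ hn (hsub ht) hct r).resolve_left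
      (not_not.2 hp1))⟩
    rw [hp2]
    exact neg_nonpos.2 (Real.sqrt_nonneg _)
  have hcontτ : ContinuousOn (fun t => φ (c t s₀).2.2 t) (Icc (-a) τ) := by
    have h1 : ContinuousOn (fun t => c t s₀) (Icc (-a) τ) :=
      (hS.continuousOn_trajectory hd₁ hd₂ hn hc s₀).mono (hsub.trans hS.Ico_subset)
    exact hφ.continuousOn.comp (f := fun t => ((c t s₀).2.2, t))
      (((continuous_snd.comp continuous_snd).comp_continuousOn h1).prodMk continuousOn_id)
      fun t ht => ⟨(hc t (hS.Ico_subset (hsub ht))).H_mem_Ioo hn s₀, hS.Ico_subset (hsub ht)⟩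
  have hτs₀ : -(Real.pi / 2) < φ (c τ s₀).2.2 τ :=
    IsPreconnected.lt_of_forall_ne (f := fun t => φ (c t s₀).2.2 t) isPreconnected_Icc hcontτ
      (x := -a) ⟨le_rfl, hτ.1⟩ (hφ.start_gt hn hS (hc (-a) (hS.Ico_subset ⟨le_rfl, by
        linarith [hS.a_pos]⟩)) s₀) (fun t ht => hne t ht s₀ le_rfl) τ ⟨hτ.1, le_rfl⟩
  have hcτ := hc τ (hS.Ico_subset hτ)
  have hψ := hφ.continuous_comp hn (hS.Ico_subset hτ) hcτ
  have hback : ∀ r ≤ s₀, -(Real.pi / 2) < φ (c τ r).2.2 τ := fun r hr =>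
    IsPreconnected.lt_of_forall_ne (f := fun r => φ (c τ r).2.2 τ) isPreconnected_Iic
      hψ.continuousOn (mem_Iic.2 le_rfl) hτs₀ (fun t ht => hne τ ⟨hτ.1, le_rfl⟩ t ht) r hr
  have hlimΔ : Tendsto (fun s => (c τ s).2.1) atBot (𝓝 (1 / d₁)) :=
    ((continuous_fst.comp continuous_snd).tendsto _).comp
      (hS.tendsto_p₁plus hd₁ hd₂ hn hτ hcτ)
  have h1 : (0 : ℝ) < 1 / d₁ := by positivity
  obtain ⟨r, hr1, hr2⟩ := ((hlimΔ.eventually (lt_mem_nhds h1)).and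
    (eventually_le_atBot (min s s₀))).exists
  have hr : 0 < φ (c τ r).2.2 τ := by
    have hlow := hback r (hr2.trans (min_le_right _ _))
    have hp := (hφ.isPolarAngle hn (hS.Ico_subset hτ) hcτ r).2
    simp only at hp
    rw [hp] at hr1
    have hsin := pos_of_mul_pos_right hr1 (Real.sqrt_nonneg _)
    by_contra hcon
    have := Real.sin_nonpos_of_nonpos_of_neg_pi_le (not_lt.1 hcon) (by linarith)
    linarith
  refine pos_of_forall_zero_hasDerivAt_pos (f := fun s => φ (c τ s).2.2 τ) (a := r) (b := s)
    hψ.continuousOn hr (fun t _ h0 => ⟨_, ?_, hφ.hasDerivAt_comp hd₁ hd₂ hn hS hτ hcτ t⟩) s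
    ⟨hr2.trans (min_le_left _ _), le_rfl⟩
  -- At angle 0 one has Δ = 0, and the angular velocity reduces to Z²/Z².
  have hp := (hφ.isPolarAngle hn (hS.Ico_subset hτ) hcτ t).2
  simp only at hp
  rw [h0, Real.sin_zero, mul_zero] at hp
  have hZ : (c τ t).1 ≠ 0 := (hS.ne_zero hd₁ hd₂ hn hτ hcτ t).resolve_right (not_not.2 hp)
  rw [hp]
  have : 0 < (c τ t).1 ^ 2 := by positivity
  refine div_pos ?_ (by positivity)
  linarith

/-- Up to an error that is small near the axis `Z = Δ = 0`, the angle of a trajectory moves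
according to `angleField`. -/
theorem angleField_sub_le (hn : d₁ + d₂ = 9) {Z Δ H θ η : ℝ} (hη : η ≤ 1)
    (hZ : |Z| ≤ η) (hΔ : |Δ| ≤ η) (hH : |H| ≤ 1) (hne : Z ≠ 0 ∨ Δ ≠ 0)
    (hp : IsPolarAngle (Z, Δ) θ) :
    angleField H θ - 20 * η ≤
      (Z * (Δ * H * (d₁ * d₂ / 9 * Δ ^ 2 - 8 / 9) + Z)
        - Δ * (2 / 9 * Δ * (d₁ * d₂ * Z * Δ * H + d₁ * d₂ / 9 * Δ ^ 2 - 8 / 9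
          + ((d₁ : ℝ) - d₂) * Z))) / (Z ^ 2 + Δ ^ 2) := by
  have hr0 : 0 < Z ^ 2 + Δ ^ 2 := by rcases hne with h | h <;> positivity
  have hη0 : 0 ≤ η := (abs_nonneg _).trans hZ
  rw [le_div_iff₀ hr0]
  have hrr := Real.sq_sqrt hr0.le
  obtain ⟨h1, h2⟩ := hp
  simp only at h1 h2
  have e : angleField H θ * (Z ^ 2 + Δ ^ 2)
      = Z ^ 2 + 16 / 81 * Δ ^ 2 - 8 / 9 * H * Z * Δ := by
    generalize √(Z ^ 2 + Δ ^ 2) = r at hrr h1 h2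
    rw [← hrr, angleField, h1, h2]
    ring
  have h21 := mul_le_twenty_one hn
  have hd0 : (0 : ℝ) ≤ d₁ * d₂ := by positivity
  have hdd : |(d₁ : ℝ) - d₂| ≤ 9 := by
    have b1 : (0 : ℝ) ≤ d₁ := Nat.cast_nonneg _
    have b2 : (0 : ℝ) ≤ d₂ := Nat.cast_nonneg _
    rw [abs_le]
    constructor <;> linarith [cast_add_eq_nine hn]
  have hΔ1 : |Δ| ≤ 1 := hΔ.trans hη
  have hsq : Δ ^ 2 ≤ η := by
    rw [← sq_abs, sq]
    exact (mul_le_of_le_one_right (abs_nonneg _) hΔ1).trans hΔ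
  have b1 : |Z * Δ * H| ≤ η := by
    rw [abs_mul, abs_mul]
    calc |Z| * |Δ| * |H| ≤ η * 1 * 1 := by gcongr
      _ = η := by ring
  have b2 : |((d₁ : ℝ) - d₂) * Z| ≤ 9 * η := by
    rw [abs_mul]; gcongr
  have b3 : d₁ * d₂ * |Z * Δ * H| ≤ 21 * η := by gcongr
  have b4 : d₁ * d₂ * Δ ^ 2 ≤ 21 * η := by gcongr
  have b5 : (d₁ * d₂ : ℝ) * (Z * Δ * H) ≤ 21 * η :=
    (mul_le_mul_of_nonneg_left (le_abs_self _) hd0).trans b3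
  have b6 : -(21 * η) ≤ (d₁ * d₂ : ℝ) * (Z * Δ * H) := by
    have := mul_le_mul_of_nonneg_left (neg_abs_le (Z * Δ * H)) hd0
    linarith
  have b7 := (abs_le.1 b2).2
  -- All deviations from the linearized numerator carry a factor Δ²; this is the cofactor. The
  -- constant 20 is generous.
  have hX : 1 / 9 * (d₁ * d₂ * (Z * Δ * H)) + 2 / 81 * (d₁ * d₂ * Δ ^ 2)
      + 2 / 9 * (((d₁ : ℝ) - d₂) * Z) ≤ 20 * η := by linarith
  have hm := mul_le_mul_of_nonneg_left hX (sq_nonneg Δ)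
  have hz := mul_nonneg (mul_nonneg (by norm_num : (0 : ℝ) ≤ 20) hη0) (sq_nonneg Z)
  linarith [e]

end SliceFamily

/-- Needed only to bound the extra barrier speed d₁d₂Δ² · (`angleField` - δ) caused by H moving
faster than on the cone. -/
theorem angleField_le_three {H θ : ℝ} (hH : |H| ≤ 1) : angleField H θ ≤ 3 := by
  have h : |H * Real.sin θ * Real.cos θ| ≤ 1 := by
    rw [abs_mul, abs_mul]
    exact mul_le_one₀ (mul_le_one₀ hH (abs_nonneg _) (Real.abs_sin_le_one _)) (abs_nonneg _)
      (Real.abs_cos_le_one _)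
  have := (abs_le.1 h).1
  rw [angleField]
  linarith [Real.sin_sq_le_one θ, Real.cos_sq_le_one θ]

theorem hasDerivAt_artanh {x : ℝ} (hx : x ∈ Ioo (-1 : ℝ) 1) :
    HasDerivAt Real.artanh (1 / (1 - x ^ 2)) x := by
  have h1 : 1 + x ≠ 0 := by linarith [hx.1]
  have h2 : 1 - x ≠ 0 := by linarith [hx.2]
  have h := (((hasDerivAt_id x).const_add 1).div ((hasDerivAt_id x).const_sub 1) h2).log
    (div_ne_zero h1 h2) |>.const_mul (1 / 2)
  have h3 : (1 - x ^ 2) ≠ 0 := by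
    rw [show 1 - x ^ 2 = (1 + x) * (1 - x) by ring]; exact mul_ne_zero h1 h2
  have hd : HasDerivAt (fun y => 1 / 2 * Real.log ((1 + y) / (1 - y))) (1 / (1 - x ^ 2)) x := by
    convert! h using 1
    simp only [id, Pi.div_apply]
    field_simp
    ring
  refine hd.congr_of_eventuallyEq ?_
  filter_upwards [Ioo_mem_nhds hx.1 hx.2] with y hy
  exact Real.artanh_eq_half_log (Ioo_subset_Icc_self hy)

/-- The barrier angle along a trajectory, as a function of time. -/
theorem IsBarrierAngle.hasDerivAt_comp {δ : ℝ} {φbar : ℝ → ℝ} (h : IsBarrierAngle 9 δ φbar)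
    (hn : d₁ + d₂ = 9) {γ : ℝ → ℝ → Phase} {τ : ℝ} {c : ℝ → Phase}
    (hc : IsTrajectoryThrough d₁ d₂ γ τ c) (s : ℝ) :
    HasDerivAt (fun s => φbar (c s).2.2)
      ((d₁ * d₂ * (c s).2.1 ^ 2 + 1) * (angleField (c s).2.2 (φbar (c s).2.2) - δ)) s := by
  have hH := hc.H_mem_Ioo hn
  have h1 := (hasDerivAt_artanh (hH s)).comp s (hc.isSolution.hasDerivAt_H hn s)
  have h2 := (h.hasDerivAt_comp_tanh (Real.artanh (c s).2.2)).comp s h1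
  have he : (fun s => φbar (c s).2.2)
      = (fun T => φbar (Real.tanh T)) ∘ (Real.artanh ∘ fun s => (c s).2.2) := by
    funext t
    simp only [Function.comp_apply, Real.tanh_artanh (hH t)]
  rw [he]
  convert! h2 using 1
  rw [Real.tanh_artanh (hH s)]
  have : 1 - (c s).2.2 ^ 2 ≠ 0 := by nlinarith [(hH s).1, (hH s).2]
  field_simp

/-- Along every trajectory the height is at least that of the cone solution in the past. -/
theorem IsTrajectoryThrough.neg_tanh_le (hn : d₁ + d₂ = 9) {γ : ℝ → ℝ → Phase} {τ : ℝ}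
    {c : ℝ → Phase} (hc : IsTrajectoryThrough d₁ d₂ γ τ c) {s : ℝ} (hs : s ≤ 0) :
    -s / 9 ≤ Real.artanh (c s).2.2 := by
  have hH := hc.H_mem_Ioo hn
  have hd : ∀ s, HasDerivAt (fun s => Real.artanh (c s).2.2 + s / 9)
      (-(d₁ * d₂ * (c s).2.1 ^ 2) / 9) s := fun s => by
    have h1 := ((hasDerivAt_artanh (hH s)).comp s (hc.isSolution.hasDerivAt_H hn s)).add
      ((hasDerivAt_id s).div_const 9)
    convert! h1 using 1
    have : 1 - (c s).2.2 ^ 2 ≠ 0 := by nlinarith [(hH s).1, (hH s).2]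
    field_simp
    ring
  have hanti : Antitone fun s => Real.artanh (c s).2.2 + s / 9 := by
    refine antitone_of_deriv_nonpos (fun s => (hd s).differentiableAt) fun s => ?_
    rw [(hd s).deriv]
    have : 0 ≤ (d₁ * d₂ : ℝ) * (c s).2.1 ^ 2 := by positivity
    linarith
  have := hanti hs
  simp only [hc.H_zero, Real.artanh_zero] at this
  linarith

/-- The angle of trajectories close to the cone solution exceeds the barrier angle. -/
theorem exists_barrierAngle_lt (hd₁ : 2 ≤ d₁) (hd₂ : 2 ≤ d₂) (hn : d₁ + d₂ = 9) {δ ε : ℝ}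
    (hδ : δ ∈ Ioo 0 1) (hε : ε ∈ Ioo 0 (2 / 129)) {a b : ℝ} {γ : ℝ → ℝ → Phase}
    {φ : ℝ → ℝ → ℝ} {φbar : ℝ → ℝ} (hS : IsSliceFamily d₁ d₂ a b γ) (hφ : IsAngle b γ φ)
    (hb : IsBarrierAngle 9 δ φbar) (hneg : ∀ h ∈ Ico (127 / 129 : ℝ) 1, φbar h < 0) :
    ∃ τ₀ > 0, τ₀ ≤ a ∧ ∀ τ ∈ Ico (-τ₀) 0, ∀ h ∈ Icc 0 (1 - ε), φbar h < φ h τ := by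
  choose! c hc using fun τ (hτ : τ ∈ Ico (-b) 0) => hS.exists_trajectory hd₁ hd₂ hn hτ
  obtain ⟨K, hK⟩ := exists_dist_solution_le hd₁ hd₂ hn
  have hε1 : 1 - ε ∈ Ioo (-1 : ℝ) 1 := ⟨by linarith [hε.2], by linarith [hε.1]⟩
  -- The time the cone solution takes from height 1 - ε to 0. Other trajectories descend at least as
  -- fast in artanh H, so at time -S they are at least as high.
  set S : ℝ := 9 * Real.artanh (1 - ε) with hSdef
  have hS0 : 0 ≤ S := by
    have := Real.artanh_nonneg (x := 1 - ε) (by linarith [hε.2])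
    linarith
  set M := Real.exp (|K| * S) with hM
  have hM0 : 0 < M := Real.exp_pos _
  -- The errors in the comparison total 20η for the angle and 21η · 3 for the barrier, and 83η < δ.
  set η : ℝ := δ / 200 with hη
  have hη0 : 0 < η := by have := hδ.1; positivity
  have hη1 : η ≤ 1 := by rw [hη]; linarith [hδ.2]
  have hev : ∀ᶠ τ in 𝓝[<] (0 : ℝ), dist (γ 0 τ) (0, 0, 0) < η / M :=
    (Metric.tendsto_nhds.1 hS.tendsto_cone) _ (by positivity)
  obtain ⟨l, hl, hl'⟩ := mem_nhdsLT_iff_exists_Ico_subset.1 hev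
  have hl0 : l < 0 := hl
  refine ⟨min a (-l), lt_min hS.a_pos (by linarith), min_le_left _ _, fun τ hτ => ?_⟩
  have hτa : τ ∈ Ico (-a) 0 := ⟨by linarith [hτ.1, min_le_left a (-l)], hτ.2⟩
  have hτb := hS.Ico_subset hτa
  have hclose : dist (γ 0 τ) (0, 0, 0) < η / M :=
    hl' ⟨by linarith [hτ.1, min_le_right a (-l)], hτ.2⟩
  have hcτ := hc τ hτb
  have hHm := hcτ.H_mem_Ioo hn
  have hanti := hcτ.strictAnti_H hn
  have hsmall : ∀ s ∈ Icc (-S) 0, |(c τ s).1| ≤ η ∧ |(c τ s).2.1| ≤ η := by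
    intro s hs
    have h1 := hK _ _ hcτ.isSolution (isSolution_coneSolution hn) hcτ.mem_locus
      (coneSolution_zero_mem_locus hn) s
    have h2 : coneSolution 0 = (0, 0, 0) := by simp [coneSolution]
    have h3 : Real.exp (K * |s|) ≤ M := by
      rw [hM]
      refine Real.exp_le_exp.2 ?_
      rw [abs_of_nonpos hs.2]
      exact mul_le_mul (le_abs_self K) (by linarith [hs.1]) (by linarith [hs.2]) (abs_nonneg K)
    have h4 : dist (c τ s) (coneSolution s) ≤ η := by
      refine h1.trans ?_
      rw [h2, hcτ.zero]
      calc _ ≤ η / M * M := by gcongr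
        _ = η := by field_simp
    rw [Prod.dist_eq, Prod.dist_eq] at h4
    have h5 := (le_max_left _ _).trans h4
    have h6 := (le_max_left _ _).trans ((le_max_right _ _).trans h4)
    simp only [coneSolution, Real.dist_eq, sub_zero] at h5 h6
    exact ⟨h5, h6⟩
  have hbot : 1 - ε ≤ (c τ (-S)).2.2 := by
    have h1 := hcτ.neg_tanh_le hn (s := -S) (by linarith)
    rw [neg_neg, hSdef, mul_div_cancel_left₀ _ (by norm_num : (9 : ℝ) ≠ 0)] at h1
    exact (Real.artanh_le_artanh_iff hε1 (hHm _)).1 h1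
  have hd := hφ.hasDerivAt_comp hd₁ hd₂ hn hS hτa hcτ
  have hdb := hb.hasDerivAt_comp hn hcτ
  have hcmp : ∀ s ∈ Icc (-S) 0, 0 < φ (c τ s).2.2 τ - φbar (c τ s).2.2 := by
    refine pos_of_forall_zero_hasDerivAt_pos
      (fun s _ => ((hd s).sub (hdb s)).continuousAt.continuousWithinAt) ?_
      (fun s hs h0 => ⟨_, ?_, (hd s).sub (hdb s)⟩)
    · have h1 := hφ.pos hd₁ hd₂ hn hS hc hτa (-S)
      have h2 := hneg (c τ (-S)).2.2 ⟨by linarith [hε.2], (hHm _).2⟩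
      linarith
    · obtain ⟨hZ, hΔ⟩ := hsmall s hs
      have hH1 : |(c τ s).2.2| ≤ 1 := abs_le.2 ⟨(hHm s).1.le, (hHm s).2.le⟩
      have h1 := angleField_sub_le hn hη1 hZ hΔ hH1 (hS.ne_zero hd₁ hd₂ hn hτa hcτ s)
        (hφ.isPolarAngle hn hτb hcτ s)
      rw [← sub_eq_zero.1 h0]
      have h3 := angleField_le_three (θ := φ (c τ s).2.2 τ) hH1
      have hsq : (c τ s).2.1 ^ 2 ≤ η := by
        rw [← sq_abs, sq]
        exact (mul_le_of_le_one_right (abs_nonneg _) (hΔ.trans hη1)).trans hΔ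
      have h5 : (d₁ * d₂ : ℝ) * (c τ s).2.1 ^ 2 ≤ 21 * η := by
        have := mul_le_twenty_one hn
        gcongr
      have h6 : (0 : ℝ) ≤ (d₁ * d₂ : ℝ) * (c τ s).2.1 ^ 2 := by positivity
      have h7 : (d₁ * d₂ : ℝ) * (c τ s).2.1 ^ 2 * (angleField (c τ s).2.2 (φ (c τ s).2.2 τ) - δ)
          ≤ 21 * η * 3 :=
        (mul_le_mul_of_nonneg_left (by linarith [hδ.1]) h6).trans
          (mul_le_mul_of_nonneg_right h5 (by norm_num))
      have h8 : η = δ / 200 := hη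
      linarith
  intro h hh
  obtain ⟨s, hs, hsh⟩ := intermediate_value_Icc' (f := fun s => (c τ s).2.2) (a := -S) (b := 0)
    (by linarith) (continuous_snd.comp (continuous_snd.comp
      hcτ.isSolution.continuous)).continuousOn
    ⟨hcτ.H_zero.le.trans hh.1, hh.2.trans hbot⟩
  have := hcmp s hs
  simp only at hsh
  rw [hsh] at this
  linarith

/-- The winding angle of the initial slice curve exceeds `2π`. -/
theorem IsAngle.windingAngleGT (hd₁ : 2 ≤ d₁) (hd₂ : 2 ≤ d₂) (hn : d₁ + d₂ = 9) {δ : ℝ}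
    (hδ : 0 < δ) {a b τ₀ : ℝ} {γ : ℝ → ℝ → Phase} {φ : ℝ → ℝ → ℝ}
    (hS : IsSliceFamily d₁ d₂ a b γ) (hφ : IsAngle b γ φ) (hτ₀ : 0 < τ₀)
    (hlt : ∀ τ ∈ Ico (-τ₀) 0, 3 / 2 * Real.pi + δ < φ 0 τ) :
    WindingAngleGT (fun τ => toPlane (γ 0 τ)) (-b) 0 (2 * Real.pi) := by
  have hab := hS.a_lt_b
  -- The difference between the final bound 3π/2 + δ and the initial angle -π/2.
  refine ⟨2 * Real.pi + δ, by linarith, ?_⟩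
  filter_upwards [Ioo_mem_nhdsGT hτ₀] with e he
  have hsub : Icc (-b) (0 - e) ⊆ Ico (-b) 0 := fun t ht => ⟨ht.1, by linarith [ht.2, he.1]⟩
  refine ⟨φ 0 (0 - e) - φ 0 (-b), ?_, ?_, φ 0, ?_, fun t ht => ?_, rfl⟩
  · rw [hφ.normalized]
    linarith [hlt (0 - e) ⟨by linarith [he.2], by linarith [he.1]⟩]
  · intro t ht h0
    have hZ : (γ 0 t).1 = 0 := congrArg Prod.fst h0
    have hΔ : (γ 0 t).2.1 = 0 := congrArg Prod.snd h0
    rcases lt_or_ge t (-a) with hta | hta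
    · rcases eq_or_lt_of_le ht.1 with hbt | hbt
      · rw [← hbt, hS.start] at hΔ
        simp only [q₁plus, neg_eq_zero] at hΔ
        have := cast_add_eq_nine hn
        have h14 := fourteen_le_mul hd₁ hd₂ hn
        exact (Real.sqrt_pos.2 (div_pos (by linarith) (by linarith) :
          0 < ((d₁ : ℝ) + d₂ - 1) / (d₁ * d₂))).ne' hΔ
      · exact (hS.half_plane t ⟨hbt, hta.le⟩).ne' hZ
    · obtain ⟨c, hc⟩ := hS.exists_trajectory hd₁ hd₂ hn (hsub ht)
      have := hS.ne_zero hd₁ hd₂ hn ⟨hta, (hsub ht).2⟩ hc 0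
      rw [hc.zero] at this
      exact this.elim (· hZ) (· hΔ)
  · exact hφ.continuousOn.comp (f := fun τ => ((0 : ℝ), τ)) (by fun_prop)
      fun τ hτ => ⟨by norm_num, hsub hτ⟩
  · exact hφ.polar 0 (by norm_num) t (hsub ht)

end EinsteinODE

theorem mainTheorem4 (d₁ d₂ : ℕ) (hd₁ : 2 ≤ d₁) (hd₂ : 2 ≤ d₂) (hn : d₁ + d₂ = 9) :
    ∃ δ₀ > (0 : ℝ), ∃ ε₀ > (0 : ℝ),
      ∀ δ ∈ Set.Ioo 0 δ₀, ∀ ε ∈ Set.Ioo 0 ε₀,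
      ∀ (a b : ℝ) (γ : ℝ → ℝ → EinsteinODE.Phase) (φ : ℝ → ℝ → ℝ) (φbar : ℝ → ℝ),
        EinsteinODE.IsSliceFamily d₁ d₂ a b γ →
        EinsteinODE.IsAngle b γ φ →
        EinsteinODE.IsBarrierAngle 9 δ φbar →
        (∃ τ₀ > (0 : ℝ), τ₀ ≤ b ∧
          ∀ τ ∈ Set.Ico (-τ₀) 0, ∀ h ∈ Set.Icc 0 (1 - ε), φbar h < φ h τ) ∧
        EinsteinODE.WindingAngleGT (fun τ => EinsteinODE.toPlane (γ 0 τ)) (-b) 0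
          (2 * Real.pi) := by
  obtain ⟨δ₀, hδ₀, hδ₀', hneg⟩ := EinsteinODE.exists_forall_barrierAngle_neg
  -- 2/129 = 1 - 127/129, so that height 1 - ε lies where the barrier angle is known to be negative.
  refine ⟨δ₀, hδ₀, 2 / 129, by norm_num, ?_⟩
  intro δ hδ ε hε a b γ φ φbar hS hφ hb
  obtain ⟨τ₀, hτ₀, hτ₀a, hlt⟩ := EinsteinODE.exists_barrierAngle_lt hd₁ hd₂ hn
    ⟨hδ.1, by linarith [hδ.2]⟩ hε hS hφ hb (hneg δ hδ φbar hb)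
  refine ⟨⟨τ₀, hτ₀, hτ₀a.trans hS.a_lt_b.le, hlt⟩, ?_⟩
  refine hφ.windingAngleGT hd₁ hd₂ hn hδ.1 hS hτ₀ fun τ hτ => ?_
  rw [← hb.initial]
  exact hlt τ hτ 0 ⟨le_rfl, by linarith [hε.2]⟩
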